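/- **Setting.** Let $K$ be a field, complete for a discrete valuation $\mathrm{val}:K\to\mathbb Z\cup\{+\infty\}$ with $\mathrm{val}(K^\times)=\mathbb Z$; let $K^\circ$ be its valuation ring, $\pi$ an element of valuation $1$ and $k=K^\circ/\pi K^\circ$. Let $K^\circ\{X\}$ be the ring of power series $\sum a_iX^i$ in $n$ variables with $a_i\in K^\circ$ and $\mathrm{val}(a_i)\to+\infty$, with the Gauss valuation $\mathrm{val}(\sum a_iX^i)=\min_i \mathrm{val}(a_i)$. Fix a monomial order $\le_\omega$ on $\mathbb N^n$. Monomials $\pi^aX^i$, i.e. pairs $(a,i)\in\mathbb N\times\mathbb N^n$ (with componentwise multiplication, divisibility and lcm), are ordered by $(a,i)<(b,j)$ iff $a>b$, or $a=b$ and $i<_\omega j$. For $0\neq f=\sum a_iX^i$, the leading term $LT(f)$ is the nonzero term $a_iX^i$ whose monomial $(\mathrm{val}(a_i),i)$ is largest, and $LM(f)$ is this monomial; $LM(0)=0$ is smaller than all monomials, and $t\cdot 0=0$ for every monomial $t$. A pair $(u,v)$ consists of a signature $u$ (a monomial or $0$) and $v\in K^\circ\{X\}$; put $t(u,v)=(tu,tv)$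 for a monomial $t$. * *J-pair.* For $v_1v_2\ne0$ put $t=\mathrm{lcm}(LM(v_1),LM(v_2))$ and $t_i=t/LM(v_i)$. The J-pair of $(u_1,v_1)$ and $(u_2,v_2)$ is $t_1(u_1,v_1)$ if $t_1u_1>t_2u_2$, it is $t_2(u_2,v_2)$ if $t_1u_1<t_2u_2$, and it is undefined if $t_1u_1=t_2u_2$ or $v_1v_2=0$. * *Cover.* $(u,v)$ is covered by $G$ if there is $(u',v')\in G$ with $u'\neq0$ dividing $u$ and $\frac{u}{u'}LM(v')<LM(v)$. * *Regular reduction.* A regular top-reduction of $w$ by $G$ at signature $u$ replaces $w\ne0$ by $w-tv'$, where $(u',v')\in G$, $v'\neq0$, $t=LT(w)/LT(v')$ is an integral term, and $\mathrm{mon}(t)u'<u$. The call $\mathsf{regular\_reduce}(u,v,G)$ performs finitely many successive regular top-reductions starting from $v$, until no further one is possible; it may also be interrupted at any point at which the valuation is larger than $\mathrm{val}(v)$. (A call that never returns does not yield a run.) **VaPoTe algorithm** on input $f_1,\dots,f_m\in K^\circ\{X\}$. Start with $Q=(f_1,\dots,f_m)$ and $\mathit{GBasis}=\emptyset$. While $Q\ne\emptyset$: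 1. pop from $Q$ an $f$ of smallest valuation; set $G=\{(0,g):g\in \mathit{GBasis}\}\cup\{(1,f)\}$, $S=\{LM(g):0\ne g\in \mathit{GBasis}\}$, and let $B$ be the set of the J-pairs of $(1,f)$ and $(0,g)$ that are defined, for $g\in \mathit{GBasis}$; 2. while $B\neq\emptyset$: pop from $B$ a pair $(u,v)$ with smallest $u$; if $(u,v)$ is covered by $G$, or if $u$ is divisible by an element of $S$, discard it. Otherwise let $v_0=\mathsf{regular\_reduce}(u,v,G)$. If $\mathrm{val}(v_0)>\mathrm{val}(f)$, add $u$ to $S$ and $v_0$ to $Q$; else add to $B$ all J-pairs of $(u,v_0)$ with elements of $G$ that are defined, and then add $(u,v_0)$ to $G$; 3. set $\mathit{GBasis}=\{v:(u,v)\in G\text{ for some }u\}$. A run is the finite or infinite sequence of the successive states of the algorithm, for arbitrary admissible choices; it stops only when $Q$ is empty at the head of the main loop. **Notation.** Fix a run. For $N\in\mathbb Z$ let $Q_{\le N}$ (resp. $Q_{>N}$) be the set of all series of valuation $\le N$ (resp. $>N$) that are popped from $Q$ during the run. Let $\tau_N$ be the first time at which the run is at the head of the main loop with $Q\subset\pi^NK^\circ\{X\}$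 (which includes the exit of the loop, where $Q=\emptyset$), and $\mathit{GBasis}_N$ the value of $\mathit{GBasis}$ at the time $\tau_N$. For $f\ne 0$ put $\nu(f)=\pi^{-\mathrm{val}(f)}f$, put $\nu(0)=0$, and let $\rho(f)$ be the image of $\nu(f)$ in $k[X]$. Let $I=\langle f_1,\dots,f_m\rangle$, $I_N=I\cap\pi^NK^\circ\{X\}$, and let $\bar I_N$ be the image of $\pi^{-N}I_N$ in $k[X]$. Let $\varphi_N:(K^\circ\{X\})^{Q_{\le N}}\to K^\circ\{X\}$ be the linear map $(a_f)\mapsto\sum_{f\in Q_{\le N}}a_f\,\nu(f)$, and $S_N=\{(a_f):\sum_f a_f\,\nu(f)\equiv0 \bmod \pi\}$. **Proposition.** For every run of the VaPoTe algorithm on $f_1,\dots,f_m$ and every $N\in\mathbb Z$, the set $Q_{\le N}$ is finite, the checkpoint $\tau_{N+1}$ is reached in finite time, and: (a) the family $\rho(\mathit{GBasis}_{N+1})$ is a (finite) Gröbner basis of $\bar I_N$ for $\le_\omega$, i.e. it consists of elements of $\bar I_N$, and the leading monomial of every nonzero element of $\bar I_N$ is divisible by the leading monomial of a nonzero element of the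 family; (b) $\varphi_N(S_N)\subset\langle \pi\cdot\nu(Q_{\le N}),\ \pi^{-N}Q_{>N}\rangle$; (c) $I_{N+1}=\langle\pi^{N+1}\cdot\nu(Q_{\le N+1}),\ Q_{>N+1}\rangle$; (d) $\bar I_{N+1}=\langle\rho(Q_{\le N+1})\rangle$. -/

import Mathlib

namespace Tate

/-! ### The discretely valued field and its Tate algebra -/

section TateAlgebra

variable {K : Type*} [Field K] (v : AddValuation K (WithTop ℤ))

/-- `K` is complete for the distance defined by the valuation `v`:
every Cauchy sequence of elements of `K` converges. -/
def IsCompleteField : Prop :=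
  ∀ a : ℕ → K,
    (∀ m : ℤ, ∃ i₀, ∀ i ≥ i₀, ∀ j ≥ i₀, (m : WithTop ℤ) ≤ v (a i - a j)) →
    ∃ l : K, ∀ m : ℤ, ∃ i₀, ∀ i ≥ i₀, (m : WithTop ℤ) ≤ v (a i - l)

/-- The uniformizers of `K`: the elements of valuation `1`. -/
abbrev Uniformizer : Type _ := {x : K // v x = 1}

/-- The valuation ring `K°`. -/
def valRing : ValuationSubring K where
  carrier := {x | 0 ≤ v x}
  mul_mem' {a b} ha hb := by
    simp only [Set.mem_ofPred_eq, v.map_mul] at *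
    exact add_nonneg ha hb
  one_mem' := by simp
  add_mem' {a b} ha hb := v.map_le_add ha hb
  zero_mem' := by simp
  neg_mem' {a} ha := by simpa [v.map_neg] using ha
  mem_or_inv_mem' x := by
    simp only [Set.mem_ofPred_eq]
    by_cases hx : x = 0
    · left; simp [hx]
    · have h : v x + v x⁻¹ = 0 := by rw [← v.map_mul, mul_inv_cancel₀ hx, v.map_one]
      by_contra! hc
      have h1 : v x + v x⁻¹ < 0 := by
        calc v x + v x⁻¹ ≤ 0 + v x⁻¹ := by gcongr; exact hc.1.le
          _ = v x⁻¹ := zero_add _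
          _ < 0 := hc.2
      exact absurd h h1.ne

/-- The residue field `k` of `K°`. -/
abbrev ResField : Type _ := IsLocalRing.ResidueField (valRing v)

/-- The ring `K°{X}` of integral Tate series in `n` variables: power series `∑ aᵢ Xⁱ` with all
`aᵢ` in `K°` and with `v(aᵢ) → +∞`. -/
def IntSeries (n : ℕ) : Subring (MvPowerSeries (Fin n) K) where
  carrier := {f | (∀ i, 0 ≤ v (MvPowerSeries.coeff i f)) ∧
    ∀ m : ℤ, ∀ᶠ i in Filter.cofinite, (m : WithTop ℤ) ≤ v (MvPowerSeries.coeff i f)}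
  mul_mem' {f g} hf hg := by
    classical
    have key : ∀ p q, 0 ≤ v (MvPowerSeries.coeff p f * MvPowerSeries.coeff q g) := fun p q => by
      rw [v.map_mul]; exact add_nonneg (hf.1 p) (hg.1 q)
    refine ⟨fun i => ?_, fun m => ?_⟩
    · rw [MvPowerSeries.coeff_mul]
      exact v.map_le_sum fun x _ => key _ _
    · have h1 := Filter.eventually_cofinite.1 (hf.2 m)
      have h2 := Filter.eventually_cofinite.1 (hg.2 m)
      refine Filter.eventually_cofinite.2 ((h1.add h2).subset fun i hi => ?_)
      simp only [Set.mem_ofPred_eq, not_le] at hi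
      by_contra hcon
      refine absurd hi (not_lt.2 ?_)
      rw [MvPowerSeries.coeff_mul]
      refine v.map_le_sum fun x hx => ?_
      rw [v.map_mul]
      by_contra! hlt
      refine hcon ⟨x.1, ?_, x.2, ?_, by simpa using hx⟩
      · simp only [Set.mem_ofPred_eq, not_le]
        exact lt_of_le_of_lt (le_add_of_nonneg_right (hg.1 _)) hlt
      · simp only [Set.mem_ofPred_eq, not_le]
        exact lt_of_le_of_lt (le_add_of_nonneg_left (hf.1 _)) hlt
  one_mem' := by
    classical
    refine ⟨fun i => ?_, fun m => ?_⟩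
    · rw [MvPowerSeries.coeff_one]; split_ifs <;> simp
    · refine Filter.eventually_cofinite.2 ((Set.finite_singleton 0).subset fun i hi => ?_)
      by_contra h
      apply hi
      rw [MvPowerSeries.coeff_one, if_neg (by simpa using h)]; simp
  add_mem' {f g} hf hg := by
    refine ⟨fun i => ?_, fun m => ?_⟩
    · rw [map_add]; exact v.map_le_add (hf.1 i) (hg.1 i)
    · filter_upwards [hf.2 m, hg.2 m] with i h1 h2
      rw [map_add]; exact v.map_le_add h1 h2
  zero_mem' := by
    refine ⟨fun i => ?_, fun m => Filter.Eventually.of_forall fun i => ?_⟩ <;> simp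
  neg_mem' {f} hf := by
    refine ⟨fun i => ?_, fun m => ?_⟩
    · rw [map_neg, v.map_neg]; exact hf.1 i
    · filter_upwards [hf.2 m] with i h1
      rwa [map_neg, v.map_neg]

variable {v} {n : ℕ}

/-- The `i`-th coefficient of an integral series, as an element of `K°`. -/
def intCoeff (f : IntSeries v n) (i : Fin n →₀ ℕ) : valRing v :=
  ⟨MvPowerSeries.coeff i f.1, f.2.1 i⟩

theorem residue_eq_zero_iff (a : valRing v) :
    IsLocalRing.residue (valRing v) a = 0 ↔ 0 < v (a : K) := by
  rw [IsLocalRing.residue_eq_zero_iff, IsLocalRing.mem_maximalIdeal, mem_nonunits_iff, not_iff_comm]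
  have ha : 0 ≤ v (a : K) := a.2
  constructor
  · intro h
    have h0 : v (a : K) = 0 := le_antisymm (not_lt.1 h) ha
    have hne : (a : K) ≠ 0 := by
      intro h; rw [h, v.map_zero] at h0; exact WithTop.top_ne_coe h0
    have h1 : v (a : K) + v (a : K)⁻¹ = 0 := by
      rw [← v.map_mul, mul_inv_cancel₀ hne, v.map_one]
    have h2 : 0 ≤ v (a : K)⁻¹ := by rw [h0, zero_add] at h1; exact h1.ge
    exact IsUnit.of_mul_eq_one ⟨(a : K)⁻¹, h2⟩ (Subtype.ext (mul_inv_cancel₀ hne))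
  · rintro h hpos
    obtain ⟨b, hb⟩ := h.exists_right_inv
    have h1 : v (a : K) + v (b : K) = 0 := by
      rw [← v.map_mul, ← v.map_one]; exact congrArg v (congrArg Subtype.val hb)
    have h2 : 0 < v (a : K) + v (b : K) := add_pos_of_pos_of_nonneg hpos b.2
    exact absurd h1 h2.ne'

theorem finite_residue_support (f : IntSeries v n) :
    {i | IsLocalRing.residue (valRing v) (intCoeff f i) ≠ 0}.Finite := by
  refine (Filter.eventually_cofinite.1 (f.2.2 1)).subset fun i hi h => hi ?_
  rw [residue_eq_zero_iff]
  exact lt_of_lt_of_le (by exact_mod_cast (zero_lt_one : (0 : ℤ) < 1)) h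

/-- The polynomial over `k` obtained by reducing every coefficient of an integral series. -/
noncomputable def redPoly (f : IntSeries v n) : MvPolynomial (Fin n) (ResField v) :=
  ∑ i ∈ (finite_residue_support f).toFinset,
    MvPolynomial.monomial i (IsLocalRing.residue (valRing v) (intCoeff f i))

theorem coeff_redPoly (f : IntSeries v n) (i : Fin n →₀ ℕ) :
    (redPoly f).coeff i = IsLocalRing.residue (valRing v) (intCoeff f i) := by
  classical
  simp only [redPoly, MvPolynomial.coeff_sum, MvPolynomial.coeff_monomial, Finset.sum_ite_eq',
    Set.Finite.mem_toFinset, Set.mem_ofPred_eq]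
  split_ifs with h
  · rfl
  · exact (not_not.1 h).symm

/-- The reduction homomorphism `K°{X} → k[X]`. -/
noncomputable def red : IntSeries v n →+* MvPolynomial (Fin n) (ResField v) where
  toFun := redPoly
  map_one' := by
    classical
    ext i
    rw [coeff_redPoly, MvPolynomial.coeff_one]
    have : intCoeff (1 : IntSeries v n) i = if 0 = i then 1 else 0 := by
      apply Subtype.ext
      change MvPowerSeries.coeff i (1 : MvPowerSeries (Fin n) K) = _
      rw [MvPowerSeries.coeff_one]
      simp only [eq_comm]
      split_ifs <;> rfl
    rw [this]; split_ifs <;> simp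
  map_mul' f g := by
    classical
    ext i
    simp only [coeff_redPoly, MvPolynomial.coeff_mul, ← map_mul, ← map_sum]
    congr 1
    apply Subtype.ext
    change MvPowerSeries.coeff i (f.1 * g.1) = _
    rw [MvPowerSeries.coeff_mul]
    push_cast
    rfl
  map_zero' := by
    ext i
    rw [coeff_redPoly, MvPolynomial.coeff_zero]
    have : intCoeff (0 : IntSeries v n) i = 0 := Subtype.ext (by simp [intCoeff])
    rw [this, map_zero]
  map_add' f g := by
    ext i
    simp only [coeff_redPoly, MvPolynomial.coeff_add, ← map_add]
    congr 1

/-- The Gauss valuation `val(f) = min_i v(aᵢ)`. -/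
noncomputable def gval (f : IntSeries v n) : WithTop ℤ :=
  ⨅ i, v (MvPowerSeries.coeff i f.1)

/-- The infimum in the definition of the Gauss valuation is a minimum. -/
theorem gval_isLeast (f : IntSeries v n) :
    IsLeast (Set.range fun i => v (MvPowerSeries.coeff i f.1)) (gval f) := by
  have hbdd : BddBelow (Set.range fun i => v (MvPowerSeries.coeff i f.1)) :=
    ⟨0, by rintro _ ⟨i, rfl⟩; exact f.2.1 i⟩
  suffices h : ∃ x, IsLeast (Set.range fun i => v (MvPowerSeries.coeff i f.1)) x by
    obtain ⟨x, hx⟩ := h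
    have : gval f = x := hx.isGLB.csInf_eq ⟨x, hx.1⟩
    rwa [this]
  by_cases h0 : ∀ i, v (MvPowerSeries.coeff i f.1) = ⊤
  · exact ⟨⊤, ⟨0, h0 0⟩, by rintro _ ⟨i, rfl⟩; exact (h0 i).ge⟩
  · push Not at h0
    obtain ⟨i₀, hi₀⟩ := h0
    obtain ⟨z, hz⟩ := WithTop.ne_top_iff_exists.1 hi₀
    have hfin := Filter.eventually_cofinite.1 (f.2.2 (z + 1))
    have hmem : i₀ ∈ hfin.toFinset := by
      simp only [Set.Finite.mem_toFinset, Set.mem_ofPred_eq, not_le, ← hz]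
      exact_mod_cast Int.lt_succ z
    obtain ⟨j, _, hj⟩ := Finset.exists_min_image hfin.toFinset
      (fun i => v (MvPowerSeries.coeff i f.1)) ⟨i₀, hmem⟩
    refine ⟨_, ⟨j, rfl⟩, ?_⟩
    rintro _ ⟨i, rfl⟩
    by_cases hi : i ∈ hfin.toFinset
    · exact hj i hi
    · simp only [Set.Finite.mem_toFinset, Set.mem_ofPred_eq, not_not] at hi
      refine (hj i₀ hmem).trans (le_trans ?_ hi)
      rw [← hz]
      exact_mod_cast (Int.lt_succ z).le

theorem v_zpow (π : Uniformizer v) (z : ℤ) : v ((π : K) ^ z) = (z : WithTop ℤ) := by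
  have hn : ∀ m : ℕ, v ((π : K) ^ m) = ((m : ℤ) : WithTop ℤ) := fun m => by
    rw [v.map_pow, π.2]; simp
  have h0 : (π : K) ≠ 0 := by
    intro h
    have := π.2
    rw [h, v.map_zero] at this
    exact WithTop.top_ne_coe this
  obtain ⟨m, rfl | rfl⟩ := z.eq_nat_or_neg
  · rw [zpow_natCast]; exact hn m
  · have h : v ((π : K) ^ (-(m : ℤ))) + ((m : ℤ) : WithTop ℤ) = 0 := by
      rw [← hn m, ← v.map_mul, zpow_neg, zpow_natCast, inv_mul_cancel₀ (pow_ne_zero _ h0), v.map_one]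
    cases hx : v ((π : K) ^ (-(m : ℤ))) with
    | top => rw [hx] at h; simp at h
    | coe a =>
      rw [hx] at h
      have : a + m = 0 := by exact_mod_cast h
      have : a = -(m : ℤ) := by omega
      rw [this]

theorem nu_mem (π : Uniformizer v) (f : IntSeries v n) :
    ((π : K) ^ (-(gval f).untopD 0) • f.1) ∈ IntSeries v n := by
  have hsm : ∀ i, v (MvPowerSeries.coeff i ((π : K) ^ (-(gval f).untopD 0) • f.1)) =
      ((-(gval f).untopD 0 : ℤ) : WithTop ℤ) + v (MvPowerSeries.coeff i f.1) := fun i => by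
    rw [MvPowerSeries.coeff_smul, v.map_mul, v_zpow]
  have shift : ∀ (m z : ℤ) (x : WithTop ℤ), ((m + z : ℤ) : WithTop ℤ) ≤ x →
      (m : WithTop ℤ) ≤ ((-z : ℤ) : WithTop ℤ) + x := by
    intro m z x h
    cases x with
    | top => simp
    | coe a =>
      have : m + z ≤ a := by exact_mod_cast h
      have : m ≤ -z + a := by omega
      exact_mod_cast this
  refine ⟨fun i => ?_, fun m => ?_⟩
  · rw [hsm]
    refine shift 0 _ _ ?_
    rw [zero_add]
    have hle : gval f ≤ v (MvPowerSeries.coeff i f.1) := (gval_isLeast f).2 ⟨i, rfl⟩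
    cases hx : gval f with
    | top => rw [hx] at hle; rw [top_le_iff.1 hle]; exact le_top
    | coe a => rw [hx] at hle; simpa using hle
  · filter_upwards [f.2.2 (m + (gval f).untopD 0)] with i hi
    rw [hsm]
    exact shift _ _ _ hi

/-- The normalization `ν(f) = π^(-val(f)) f` (with `ν(0) = 0`). -/
noncomputable def nu (π : Uniformizer v) (f : IntSeries v n) : IntSeries v n :=
  ⟨(π : K) ^ (-(gval f).untopD 0) • f.1, nu_mem π f⟩

/-- `ρ(f)`, the image of `ν(f)` in `k[X]`. -/
noncomputable def rho (π : Uniformizer v) (f : IntSeries v n) :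
    MvPolynomial (Fin n) (ResField v) :=
  red (nu π f)

/-- `π^N A`, for an integer `N` (possibly negative) and a set `A` of integral series,
as a set of integral series: the members of `K°{X}` of the form `π^N f` with `f ∈ A`. -/
def scaleSet (π : Uniformizer v) (N : ℤ) (A : Set (IntSeries v n)) : Set (IntSeries v n) :=
  {g | ∃ f ∈ A, (g : MvPowerSeries (Fin n) K) = (π : K) ^ N • (f : MvPowerSeries (Fin n) K)}

/-- `π^N I`, intersected with `K°{X}`, for an ideal `I` of `K°{X}` and an integer `N`. -/
noncomputable def scaleIdeal (π : Uniformizer v) (N : ℤ) (I : Ideal (IntSeries v n)) :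
    Ideal (IntSeries v n) where
  carrier := scaleSet π N I
  add_mem' := by
    rintro a b ⟨f, hf, h1⟩ ⟨g, hg, h2⟩
    exact ⟨f + g, I.add_mem hf hg, by push_cast; rw [h1, h2, smul_add]⟩
  zero_mem' := ⟨0, I.zero_mem, by simp⟩
  smul_mem' := by
    rintro c a ⟨f, hf, h1⟩
    exact ⟨c * f, I.mul_mem_left c hf, by
      rw [smul_eq_mul]; push_cast; rw [h1, mul_smul_comm]⟩

/-- `I_N = I ∩ π^N K°{X}`. -/
noncomputable def idealLevel (π : Uniformizer v) (I : Ideal (IntSeries v n)) (N : ℤ) :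
    Ideal (IntSeries v n) :=
  I ⊓ scaleIdeal π N ⊤

/-- `Ī_N`, the image of `π^(-N) I_N` in `k[X]` under reduction (an ideal, because the
reduction map is surjective). -/
noncomputable def idealBar (π : Uniformizer v) (I : Ideal (IntSeries v n)) (N : ℤ) :
    Ideal (MvPolynomial (Fin n) (ResField v)) :=
  (scaleIdeal π (-N) (idealLevel π I N)).map red

theorem term_mem (c : valRing v) (e : Fin n →₀ ℕ) :
    MvPowerSeries.monomial e (c : K) ∈ IntSeries v n := by
  classical
  refine ⟨fun i => ?_, fun m => ?_⟩
  · rw [MvPowerSeries.coeff_monomial]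
    split_ifs
    · exact c.2
    · simp
  · refine Filter.eventually_cofinite.2 ((Set.finite_singleton e).subset fun i hi => ?_)
    by_contra h
    apply hi
    rw [MvPowerSeries.coeff_monomial, if_neg (by simpa using h)]; simp

/-- The series `c X^e`, for `c ∈ K°`. -/
noncomputable def term (c : valRing v) (e : Fin n →₀ ℕ) : IntSeries v n :=
  ⟨MvPowerSeries.monomial e (c : K), term_mem c e⟩

theorem red_surjective : Function.Surjective (red : IntSeries v n → _) := by
  intro p
  induction p using MvPolynomial.induction_on' with
  | monomial e a =>
    obtain ⟨c, rfl⟩ := IsLocalRing.residue_surjective a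
    refine ⟨term c e, ?_⟩
    classical
    ext i
    change (redPoly _).coeff i = _
    rw [coeff_redPoly, MvPolynomial.coeff_monomial]
    have : intCoeff (term c e) i = if e = i then c else 0 := by
      apply Subtype.ext
      change MvPowerSeries.coeff i (MvPowerSeries.monomial e (c : K)) = _
      rw [MvPowerSeries.coeff_monomial]
      simp only [eq_comm]
      split_ifs <;> rfl
    rw [this]; split_ifs <;> simp
  | add p q hp hq =>
    obtain ⟨a, rfl⟩ := hp
    obtain ⟨b, rfl⟩ := hq
    exact ⟨a + b, map_add _ _ _⟩

/-- The members of `Ī_N` are the reductions of the series `π^(-N) h` with `h ∈ I_N`. -/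
theorem mem_idealBar (π : Uniformizer v) (I : Ideal (IntSeries v n)) (N : ℤ)
    (p : MvPolynomial (Fin n) (ResField v)) :
    p ∈ idealBar π I N ↔ ∃ g ∈ scaleSet π (-N) (idealLevel π I N), red g = p :=
  Ideal.mem_map_iff_of_surjective _ red_surjective

end TateAlgebra

/-! ### Monomials, leading monomials, Gröbner bases -/

section Monomials

variable {n : ℕ}

/-- The monoid `ℕ × ℕⁿ` of monomials of integral Tate terms, written additively: `(a, i)` is the
class of `π^a X^i`. Divisibility is the componentwise order `≤`, least common multiples are
suprema `⊔`, and the quotient of a monomial by one of its divisors is the difference. -/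
abbrev TMon (n : ℕ) : Type := ℕ × (Fin n →₀ ℕ)

/-- Monomials together with `⊥`, the leading monomial of `0`. -/
abbrev Sig (n : ℕ) : Type := WithBot (TMon n)

/-- The monomial order on `ℕ × ℕⁿ`: lexicographic, for the reverse natural order on `ℕ` and the
given monomial order on `ℕⁿ`. It is expressed by an injection into a linear order. -/
noncomputable def ordKey (ord : MonomialOrder (Fin n)) (s : TMon n) : ℕᵒᵈ ×ₗ ord.syn :=
  toLex (OrderDual.toDual s.1, ord.toSyn s.2)

/-- The strict order on monomials, extended so that `⊥` is the smallest element. -/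
def sigLT (ord : MonomialOrder (Fin n)) (s t : Sig n) : Prop :=
  s.map (ordKey ord) < t.map (ordKey ord)

/-- The corresponding non-strict order. -/
def sigLE (ord : MonomialOrder (Fin n)) (s t : Sig n) : Prop :=
  s.map (ordKey ord) ≤ t.map (ordKey ord)

variable {K : Type*} [Field K] {v : AddValuation K (WithTop ℤ)}

/-- The valuation of a nonzero element of `K°`, as a natural number. -/
def natVal (v : AddValuation K (WithTop ℤ)) (c : K) : ℕ := ((v c).untopD 0).toNat

/-- `aᵢ Xⁱ` is the leading term of `f = ∑ aᵢ Xⁱ`: the nonzero term whose monomial is largest. -/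
def IsLead (ord : MonomialOrder (Fin n)) (f : IntSeries v n) (i : Fin n →₀ ℕ) : Prop :=
  MvPowerSeries.coeff i f.1 ≠ 0 ∧
  ∀ j, MvPowerSeries.coeff j f.1 ≠ 0 →
    ordKey ord (natVal v (MvPowerSeries.coeff j f.1), j) ≤
      ordKey ord (natVal v (MvPowerSeries.coeff i f.1), i)

open Classical in
/-- The leading monomial of `f`, which is `⊥` for `f = 0`. -/
noncomputable def LM (ord : MonomialOrder (Fin n)) (f : IntSeries v n) : Sig n :=
  if h : ∃ i, IsLead ord f i then
    ((natVal v (MvPowerSeries.coeff h.choose f.1), h.choose) : TMon n)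
  else ⊥

/-- A nonzero series has a leading term. -/
theorem exists_isLead (ord : MonomialOrder (Fin n)) {f : IntSeries v n} (hf : f ≠ 0) :
    ∃ i, IsLead ord f i := by
  have h0 : ∃ i, MvPowerSeries.coeff i f.1 ≠ 0 := by
    by_contra! h
    exact hf (Subtype.ext (MvPowerSeries.ext fun i => by simpa using h i))
  obtain ⟨i₀, hi₀⟩ := h0
  have hnat : ∀ i, MvPowerSeries.coeff i f.1 ≠ 0 →
      v (MvPowerSeries.coeff i f.1) = ((natVal v (MvPowerSeries.coeff i f.1) : ℤ) : WithTop ℤ) := by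
    intro i hi
    have h1 := f.2.1 i
    obtain ⟨z, hz⟩ := WithTop.ne_top_iff_exists.1 (v.ne_top_iff.2 hi)
    rw [natVal, ← hz]
    rw [← hz] at h1
    have h2 : 0 ≤ z := by exact_mod_cast h1
    simp [h2]
  set z := natVal v (MvPowerSeries.coeff i₀ f.1) with hz
  have hfin := Filter.eventually_cofinite.1 (f.2.2 (z + 1))
  have hmem : i₀ ∈ hfin.toFinset := by
    simp only [Set.Finite.mem_toFinset, Set.mem_ofPred_eq, not_le, hnat i₀ hi₀, ← hz]
    exact_mod_cast Int.lt_succ z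
  obtain ⟨i, hi, hmax⟩ := Finset.exists_max_image hfin.toFinset
    (fun j => ordKey ord (natVal v (MvPowerSeries.coeff j f.1), j)) ⟨i₀, hmem⟩
  refine ⟨i, ?_, fun j hj => ?_⟩
  · intro h
    simp [h] at hi
  · by_cases hj' : j ∈ hfin.toFinset
    · exact hmax j hj'
    · refine le_trans ?_ (hmax i₀ hmem)
      simp only [Set.Finite.mem_toFinset, Set.mem_ofPred_eq, not_not, hnat j hj] at hj'
      have : z < natVal v (MvPowerSeries.coeff j f.1) := by
        have h3 : (z : ℤ) + 1 ≤ natVal v (MvPowerSeries.coeff j f.1) := by exact_mod_cast hj'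
        omega
      apply le_of_lt
      rw [ordKey, ordKey, Prod.Lex.toLex_lt_toLex]
      left
      exact OrderDual.toDual_lt_toDual.2 this

/-- The leading term is unique. -/
theorem IsLead.unique {ord : MonomialOrder (Fin n)} {f : IntSeries v n} {i j : Fin n →₀ ℕ}
    (hi : IsLead ord f i) (hj : IsLead ord f j) : i = j := by
  have h := le_antisymm (hj.2 i hi.1) (hi.2 j hj.1)
  simp only [ordKey, EmbeddingLike.apply_eq_iff_eq, Prod.mk.injEq] at h
  exact h.2

/-- `G` is a (finite) Gröbner basis of the ideal `J` of `k[X]`: it consists of elements of `J`, and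
the leading monomial of each nonzero element of `J` is divisible by the leading monomial of a
nonzero element of `G`. -/
def IsGroebnerBasis {k : Type*} [Field k] (ord : MonomialOrder (Fin n))
    (G : Set (MvPolynomial (Fin n) k)) (J : Ideal (MvPolynomial (Fin n) k)) : Prop :=
  G.Finite ∧ G ⊆ J ∧
    ∀ p ∈ J, p ≠ 0 → ∃ g ∈ G, g ≠ 0 ∧ ord.degree g ≤ ord.degree p

end Monomials

/-! ### The VaPoTe algorithm as a transition system -/

section Algorithm

variable {K : Type*} [Field K] {v : AddValuation K (WithTop ℤ)} {n : ℕ}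

/-- The pairs `(u, g)` handled by the algorithm: a signature `u` and a series `g`. -/
abbrev SPair (v : AddValuation K (WithTop ℤ)) (n : ℕ) : Type _ := Sig n × IntSeries v n

/-- The pair `t · (u, g)`, for the monomial `t` represented by the term `π^a X^e`. -/
noncomputable def mulPair (π : Uniformizer v) (t : TMon n) (p : SPair v n) : SPair v n :=
  ((t : Sig n) + p.1,
    term ⟨(π : K) ^ t.1, by
      change 0 ≤ v ((π : K) ^ t.1)
      rw [← zpow_natCast, v_zpow]
      exact_mod_cast Int.natCast_nonneg t.1⟩ t.2 * p.2)

/-- The J-pair of `p₁` and `p₂` is defined, and equal to `p`. -/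
def IsJPair (ord : MonomialOrder (Fin n)) (π : Uniformizer v) (p₁ p₂ p : SPair v n) : Prop :=
  ∃ s₁ s₂ t₁ t₂ : TMon n, LM ord p₁.2 = s₁ ∧ LM ord p₂.2 = s₂ ∧
    t₁ + s₁ = s₁ ⊔ s₂ ∧ t₂ + s₂ = s₁ ⊔ s₂ ∧
    ((sigLT ord (t₁ + p₁.1) (t₂ + p₂.1) ∧ p = mulPair π t₂ p₂) ∨
     (sigLT ord (t₂ + p₂.1) (t₁ + p₁.1) ∧ p = mulPair π t₁ p₁))

/-- The pair `p` is covered by `G`: some `q ∈ G` has a nonzero signature dividing that of `p`, and,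
`t` being the quotient of the signatures, `t · LM(q) < LM(p)`. -/
def IsCovered (ord : MonomialOrder (Fin n)) (G : Set (SPair v n)) (p : SPair v n) : Prop :=
  ∃ q ∈ G, ∃ s t : TMon n, q.1 = s ∧ p.1 = (t + s : TMon n) ∧
    sigLT ord (t + LM ord q.2) (LM ord p.2)

/-- `u` is divisible by an element of `S`. -/
def IsDivisible (S : Set (TMon n)) (u : Sig n) : Prop :=
  ∃ s ∈ S, ∃ t : TMon n, u = (t + s : TMon n)

/-- One regular top-reduction by `G` at signature `u`: `w' = w - c X^e g`, where `(s, g) ∈ G`, the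
term `c X^e` is the quotient of the leading term of `w` by the one of `g`, and the signature of
`c X^e (s, g)` is smaller than `u`. -/
def RegStep (ord : MonomialOrder (Fin n)) (G : Set (SPair v n)) (u : Sig n)
    (w w' : IntSeries v n) : Prop :=
  ∃ q ∈ G, ∃ (i j e : Fin n →₀ ℕ) (c : valRing v),
    IsLead ord w i ∧ IsLead ord q.2 j ∧ i = e + j ∧
    MvPowerSeries.coeff i w.1 = (c : K) * MvPowerSeries.coeff j q.2.1 ∧
    sigLT ord (((natVal v (c : K), e) : TMon n) + q.1) u ∧
    w' = w - term c e * q.2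

/-- The possible results `w'` of the call `regular_reduce(u, w, G)`: successive regular
top-reductions are performed until no further one is possible; it is also allowed to interrupt them
once the valuation has risen. -/
def RegularReduce (ord : MonomialOrder (Fin n)) (G : Set (SPair v n)) (u : Sig n)
    (w w' : IntSeries v n) : Prop :=
  Relation.ReflTransGen (RegStep ord G u) w w' ∧
    ((∀ w'', ¬ RegStep ord G u w' w'') ∨ gval w < gval w')

/-- The states of the algorithm: `outer Q GBasis` at the head of the main loop, and
`inner Q f G S B` at the head of the inner loop. -/
inductive State (v : AddValuation K (WithTop ℤ)) (n : ℕ) : Type _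
  | outer (Q : Multiset (IntSeries v n)) (GBasis : Set (IntSeries v n))
  | inner (Q : Multiset (IntSeries v n)) (f : IntSeries v n) (G : Set (SPair v n))
      (S : Set (TMon n)) (B : Set (SPair v n))

/-- `p` can be popped from `B`: it has the smallest signature. -/
def IsMinSig (ord : MonomialOrder (Fin n)) (B : Set (SPair v n)) (p : SPair v n) : Prop :=
  p ∈ B ∧ ∀ q ∈ B, sigLE ord p.1 q.1

/-- The transitions of the algorithm. -/
inductive Step (ord : MonomialOrder (Fin n)) (π : Uniformizer v) : State v n → State v n → Prop
  /-- Pop `f` from `Q`, with smallest valuation, and initialize `G`, `S` and `B`. -/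
  | pop (Q : Multiset (IntSeries v n)) (GBasis : Set (IntSeries v n)) (f : IntSeries v n)
      (hmin : ∀ g ∈ Q, gval f ≤ gval g) :
      Step ord π (.outer (f ::ₘ Q) GBasis)
        (.inner Q f
          ({p | ∃ g ∈ GBasis, p = (⊥, g)} ∪ {(((0 : TMon n) : Sig n), f)})
          {s | ∃ g ∈ GBasis, LM ord g = s}
          {p | ∃ g ∈ GBasis, IsJPair ord π (((0 : TMon n) : Sig n), f) (⊥, g) p})
  /-- Pop a pair from `B` that is covered by `G`, or whose signature is divisible by an element
  of `S`, and discard it. -/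
  | discard (Q : Multiset (IntSeries v n)) (f : IntSeries v n) (G : Set (SPair v n))
      (S : Set (TMon n)) (B : Set (SPair v n)) (p : SPair v n) (hp : IsMinSig ord B p)
      (hdiscard : IsCovered ord G p ∨ IsDivisible S p.1) :
      Step ord π (.inner Q f G S B) (.inner Q f G S (B \ {p}))
  /-- Pop a pair from `B` that reduces to a series of larger valuation than `f`: the signature is
  added to `S` and the series to `Q`. -/
  | raise (Q : Multiset (IntSeries v n)) (f : IntSeries v n) (G : Set (SPair v n))
      (S : Set (TMon n)) (B : Set (SPair v n)) (p : SPair v n) (v₀ : IntSeries v n)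
      (hp : IsMinSig ord B p) (hcov : ¬ IsCovered ord G p) (hdiv : ¬ IsDivisible S p.1)
      (hred : RegularReduce ord G p.1 p.2 v₀) (hval : gval f < gval v₀) :
      Step ord π (.inner Q f G S B) (.inner (v₀ ::ₘ Q) f G (S ∪ {s | p.1 = s}) (B \ {p}))
  /-- Pop a pair from `B` that reduces to a series whose valuation does not exceed that of `f`: the
  J-pairs with the elements of `G` are added to `B`, and the reduced pair to `G`. -/
  | keep (Q : Multiset (IntSeries v n)) (f : IntSeries v n) (G : Set (SPair v n))
      (S : Set (TMon n)) (B : Set (SPair v n)) (p : SPair v n) (v₀ : IntSeries v n)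
      (hp : IsMinSig ord B p) (hcov : ¬ IsCovered ord G p) (hdiv : ¬ IsDivisible S p.1)
      (hred : RegularReduce ord G p.1 p.2 v₀) (hval : ¬ gval f < gval v₀) :
      Step ord π (.inner Q f G S B)
        (.inner Q f (G ∪ {(p.1, v₀)}) S
          ((B \ {p}) ∪ {q | ∃ r ∈ G, IsJPair ord π (p.1, v₀) r q}))
  /-- When `B` is empty, update `GBasis` and return to the main loop. -/
  | finish (Q : Multiset (IntSeries v n)) (f : IntSeries v n) (G : Set (SPair v n))
      (S : Set (TMon n)) :
      Step ord π (.inner Q f G S ∅) (.outer Q {g | ∃ u, (u, g) ∈ G})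

/-- A run of the algorithm on the input `f₁, …, f_m`: the sequence of its successive states. If the
main loop is exited (that is, if `Q` is empty), then the last state is repeated forever. -/
def IsRun (ord : MonomialOrder (Fin n)) (π : Uniformizer v) {m : ℕ} (f : Fin m → IntSeries v n)
    (σ : ℕ → State v n) : Prop :=
  σ 0 = .outer (Finset.univ.val.map f) ∅ ∧
    ∀ t, Step ord π (σ t) (σ (t + 1)) ∨ ((∃ GBasis, σ t = .outer 0 GBasis) ∧ σ (t + 1) = σ t)

/-- The set of all series that are popped from `Q` during the run. -/
def Qall (σ : ℕ → State v n) : Set (IntSeries v n) :=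
  {f | ∃ t Q G S B, σ t = .inner Q f G S B}

/-- `Q_{≤ N}`. -/
def Qle (σ : ℕ → State v n) (N : ℤ) : Set (IntSeries v n) :=
  {f ∈ Qall σ | gval f ≤ (N : WithTop ℤ)}

/-- `Q_{> N}`. -/
def Qgt (σ : ℕ → State v n) (N : ℤ) : Set (IntSeries v n) :=
  {f ∈ Qall σ | (N : WithTop ℤ) < gval f}

/-- At time `t` the run is at the head of the main loop with `Q ⊆ π^N K°{X}` and with `GBasis` as
the value of this variable. When the main loop is exited, `Q` is empty, and this holds. -/
def AtLevel (π : Uniformizer v) (σ : ℕ → State v n) (N : ℤ) (t : ℕ)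
    (GBasis : Set (IntSeries v n)) : Prop :=
  ∃ Q, σ t = .outer Q GBasis ∧ ∀ f ∈ Q, f ∈ scaleIdeal π N (⊤ : Ideal (IntSeries v n))

/-- `GBasis` is `GBasis_N`, the value of this variable at the checkpoint `τ_N`, the first time `t`
at which the run is at the head of the main loop with `Q ⊆ π^N K°{X}`. -/
def IsGBasisAt (π : Uniformizer v) (σ : ℕ → State v n) (N : ℤ)
    (GBasis : Set (IntSeries v n)) : Prop :=
  ∃ t, AtLevel π σ N t GBasis ∧ ∀ t' < t, ∀ GBasis', ¬ AtLevel π σ N t' GBasis'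

/-- The linear map `φ_N`, sending a family `(a_f)` indexed by `Q_{≤ N}` to `∑ a_f ν(f)`. -/
noncomputable def phi (π : Uniformizer v) (σ : ℕ → State v n) (N : ℤ) :
    (Qle σ N →₀ IntSeries v n) →ₗ[IntSeries v n] IntSeries v n :=
  Finsupp.linearCombination (IntSeries v n) fun f : Qle σ N => nu π (f : IntSeries v n)

/-- `S_N`, the module of the families `(a_f)` with `∑ a_f ν(f) ≡ 0` modulo `π`. -/
noncomputable def syzMod (π : Uniformizer v) (σ : ℕ → State v n) (N : ℤ) :
    Submodule (IntSeries v n) (Qle σ N →₀ IntSeries v n) :=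
  Submodule.comap (phi π σ N) (scaleIdeal π 1 (⊤ : Ideal (IntSeries v n)))

end Algorithm

end Tate

/-!
Write `ϖ` for the uniformizer seen as a constant series. Every series is `f = ϖ ^ nval f * ν(f)`,
a series reduces to zero modulo `π` exactly when `ϖ` divides it, and the leading monomial of `f ≠ 0`
is `(val(f), deg ρ(f))` (`LM_eq`). Because series are popped by increasing valuation, the signatures
occurring in the inner loop are monomials `X^i` without a power of `π`, and the pairs of signature
different from `⊥` all have the valuation of the series `f` being processed (`IsJPair.hasSig`). So,
after normalization and reduction, the inner loop is a signature-based computation in `k[X]`: `J`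
being the ideal generated by the reductions of the series popped before, of which a Gröbner basis is
known, it treats the ideal `J + (ρ(f))`.

When no J-pair is left, each one is covered or has a signature divisible by an element of `S`: a
pair that was kept is covered by its own reduction. The cover criterion (`IsCoveredBasis`) then
gives two facts over `k`: the reductions form a Gröbner basis of `J + (ρ(f))`, and the leading
monomials of `(J : ρ(f))` are divisible by elements of `S`. It is proved by taking, among the
multiples with a given signature, one of smallest leading monomial: such a multiple has no regular
top-reduction.

Each element `X^i` of `S` comes with a syzygy lifting to series: its value is zero if it comes from
a Koszul relation between `f` and an element of `GBasis`, and `π^(-val(f)) v₀` if the series `v₀`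
was added to `Q`. Induction on the leading monomial of the coefficient of `ρ(f)` shows that all
syzygies of the reductions of the popped series lift, that is, an element of `⟨ν(D)⟩` divisible by
`ϖ` lies in `ϖ ⟨ν(D)⟩` up to a combination of such values (`InnerInv.exists_lift_syzygy`). These
facts are carried along the run by the invariants `OuterInv` and `InnerInv`.

The inner loop terminates by Dickson's lemma, since the signature and leading monomial of a new pair
are not both divisible by those of an older one (`InnerInv.not_le_of_keep`). Each pass through the
main loop removes from `Q` an element of smallest valuation and only adds elements of larger
valuation, so all checkpoints are reached. At the checkpoint `τ_{N+1}` the popped series are those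
of `Q_{≤ N}` and the nonzero series left in `Q` are popped later (`exists_checkpoint`). The lifting
of syzygies then gives the generators of `I_N` by induction on `N` (`idealLevel_le_span`), and those
of its reduction follow.
-/

namespace Tate

/-! ### The cover criterion over a field -/

section CoverCriterion

open MvPolynomial
open scoped MonomialOrder

variable {ι k : Type*} [Field k] {ord : MonomialOrder ι}

/-- Cancelling the leading term of a polynomial gives zero or lowers its degree. -/
theorem sub_monomial_mul_eq_zero_or_degree_lt {p q : MvPolynomial ι k} {e : ι →₀ ℕ} {c : k}
    (hd : ord.degree p = e + ord.degree q)
    (hc : ord.leadingCoeff p = c * ord.leadingCoeff q) :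
    p - monomial e c * q = 0 ∨ ord.degree (p - monomial e c * q) ≺[ord] ord.degree p := by
  classical
  by_cases h0 : p - monomial e c * q = 0
  · exact Or.inl h0
  right
  have hle : ord.degree (monomial e c * q) ≼[ord] ord.degree p := by
    refine ord.degree_mul_le.trans ?_
    rw [hd, map_add, map_add]
    gcongr
    exact ord.degree_monomial_le c
  refine lt_of_le_of_ne (ord.degree_sub_le.trans (sup_le le_rfl hle)) fun heq => ?_
  have heq := ord.toSyn.injective heq
  apply (ord.coeff_degree_ne_zero_iff).2 h0
  rw [heq, coeff_sub, hd, coeff_monomial_mul, ← hd]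
  exact sub_eq_zero.2 hc

theorem degree_monomial_mul_eq {q : MvPolynomial ι k} {e : ι →₀ ℕ} {c : k} (hc : c ≠ 0)
    (hq : q ≠ 0) : ord.degree (monomial e c * q) = e + ord.degree q := by
  classical
  rw [ord.degree_mul (by simpa using hc) hq, ord.degree_monomial, if_neg hc]

/-- The pair of signature `t + i` and leading monomial `t + degree g` is covered by `G`, or its
signature is divisible by an element of `S`. -/
def CoveredOrDivisible (ord : MonomialOrder ι) (G : Set ((ι →₀ ℕ) × MvPolynomial ι k))
    (S : Set (ι →₀ ℕ)) (t i : ι →₀ ℕ) (g : MvPolynomial ι k) : Prop :=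
  (∃ i' g' t', (i', g') ∈ G ∧ t' + i' = t + i ∧ t' + ord.degree g' ≺[ord] t + ord.degree g) ∨
    ∃ s ∈ S, s ≤ t + i

/-- The situation of a signature-based Gröbner basis computation for an ideal `J + (F)` of a
polynomial ring over a field, when all J-pairs have been treated. The set `G₀` plays the role of
a Gröbner basis of `J` (elements of signature `⊥`), the members `(i, g)` of `G₁` are elements
`g ≡ b F` modulo `J` with `i` the leading monomial of `b`, and `S` consists of leading monomials of
the elements `b` with `b F ∈ J`. -/
structure IsCoveredBasis (ord : MonomialOrder ι) (J : Ideal (MvPolynomial ι k))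
    (F : MvPolynomial ι k) (G₀ : Set (MvPolynomial ι k)) (G₁ : Set ((ι →₀ ℕ) × MvPolynomial ι k))
    (S : Set (ι →₀ ℕ)) : Prop where
  exists_degree_le : ∀ p ∈ J, p ≠ 0 → ∃ g ∈ G₀, g ≠ 0 ∧ ord.degree g ≤ ord.degree p
  ne_zero : ∀ i g, (i, g) ∈ G₁ → g ≠ 0
  lift : ∀ i g, (i, g) ∈ G₁ → ∃ b ≠ 0, ord.degree b = i ∧ g - b * F ∈ J
  generator_mem : (0, F) ∈ G₁
  syzygy : ∀ s ∈ S, ∃ b ≠ 0, ord.degree b = s ∧ b * F ∈ J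
  cover_bot : ∀ i g, (i, g) ∈ G₁ → ∀ g' ∈ G₀, g' ≠ 0 → ∀ t,
    t + ord.degree g = ord.degree g ⊔ ord.degree g' → CoveredOrDivisible ord G₁ S t i g
  cover : ∀ i g, (i, g) ∈ G₁ → ∀ j g', (j, g') ∈ G₁ → ∀ t t',
    t + ord.degree g = ord.degree g ⊔ ord.degree g' →
    t' + ord.degree g' = ord.degree g ⊔ ord.degree g' → t' + j ≺[ord] t + i →
    CoveredOrDivisible ord G₁ S t i g

namespace IsCoveredBasis

variable {J : Ideal (MvPolynomial ι k)} {F : MvPolynomial ι k} {G₀ : Set (MvPolynomial ι k)}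
  {G₁ : Set ((ι →₀ ℕ) × MvPolynomial ι k)} {S : Set (ι →₀ ℕ)}

/-- Among the multiples of signature `T` of the elements of `G₁`, one has the smallest leading
monomial. -/
theorem exists_minimal (h : IsCoveredBasis ord J F G₀ G₁ S) (T : ι →₀ ℕ) :
    ∃ i g t, (i, g) ∈ G₁ ∧ t + i = T ∧ ∀ i' g' t', (i', g') ∈ G₁ → t' + i' = T →
      ¬ t' + ord.degree g' ≺[ord] t + ord.degree g := by
  obtain ⟨_, ⟨i, g, t, hg, ht, rfl⟩, hmin⟩ := (wellFounded_lt (α := ord.syn)).has_min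
    {d | ∃ i g t, (i, g) ∈ G₁ ∧ t + i = T ∧ d = ord.toSyn (t + ord.degree g)}
    ⟨_, 0, F, T, h.generator_mem, add_zero T, rfl⟩
  exact ⟨i, g, t, hg, ht, fun i' g' t' hg' ht' => hmin _ ⟨i', g', t', hg', ht', rfl⟩⟩

/-- A multiple of smallest leading monomial, for a signature `t + i` not divisible by `S`, has no
regular top-reduction by `G₀`: the J-pair expressing it would be covered. -/
theorem not_le_of_minimal_bot (h : IsCoveredBasis ord J F G₀ G₁ S) {i t : ι →₀ ℕ}
    {g : MvPolynomial ι k} (hg : (i, g) ∈ G₁)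
    (hmin : ∀ i' g' t', (i', g') ∈ G₁ → t' + i' = t + i →
      ¬ t' + ord.degree g' ≺[ord] t + ord.degree g)
    (hS : ¬ ∃ s ∈ S, s ≤ t + i) {g' : MvPolynomial ι k} (hg' : g' ∈ G₀) (h0 : g' ≠ 0) :
    ¬ ord.degree g' ≤ t + ord.degree g := by
  intro hle
  obtain ⟨t₁, ht₁⟩ := exists_add_of_le (le_sup_left : ord.degree g ≤ ord.degree g ⊔ ord.degree g')
  rw [add_comm] at ht₁
  obtain ⟨r, hr⟩ := exists_add_of_le (sup_le le_add_self hle :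
    ord.degree g ⊔ ord.degree g' ≤ t + ord.degree g)
  rw [ht₁] at hr
  have htr : t = r + t₁ := by
    apply add_right_cancel (b := ord.degree g); rw [hr]; abel
  subst htr
  rcases h.cover_bot i g hg g' hg' h0 t₁ ht₁.symm with ⟨i', g'', t', h1, h2, h3⟩ | ⟨s, hs, hs'⟩
  · refine hmin i' g'' (r + t') h1 (by rw [add_assoc, h2, add_assoc]) ?_
    rw [add_assoc, add_assoc, map_add, map_add ord.toSyn r]
    gcongr
  · exact hS ⟨s, hs, hs'.trans (by rw [add_assoc]; exact le_add_self)⟩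

/-- A multiple of smallest leading monomial, for a signature `t + i` not divisible by `S`, has no
regular top-reduction by `G₁`. -/
theorem not_lt_of_minimal (h : IsCoveredBasis ord J F G₀ G₁ S) {i t : ι →₀ ℕ}
    {g : MvPolynomial ι k} (hg : (i, g) ∈ G₁)
    (hmin : ∀ i' g' t', (i', g') ∈ G₁ → t' + i' = t + i →
      ¬ t' + ord.degree g' ≺[ord] t + ord.degree g)
    (hS : ¬ ∃ s ∈ S, s ≤ t + i) {j t' : ι →₀ ℕ} {g' : MvPolynomial ι k} (hg' : (j, g') ∈ G₁)
    (ht' : t' + ord.degree g' = t + ord.degree g) :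
    ¬ t' + j ≺[ord] t + i := by
  intro hlt
  obtain ⟨t₁, ht₁⟩ := exists_add_of_le (le_sup_left : ord.degree g ≤ ord.degree g ⊔ ord.degree g')
  obtain ⟨t₂, ht₂⟩ := exists_add_of_le (le_sup_right : ord.degree g' ≤ ord.degree g ⊔ ord.degree g')
  rw [add_comm] at ht₁ ht₂
  obtain ⟨r, hr⟩ := exists_add_of_le (sup_le le_add_self (ht' ▸ le_add_self) :
    ord.degree g ⊔ ord.degree g' ≤ t + ord.degree g)
  have htr : t = r + t₁ := by
    rw [ht₁] at hr; apply add_right_cancel (b := ord.degree g); rw [hr]; abel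
  have htr' : t' = r + t₂ := by
    rw [← ht', ht₂] at hr; apply add_right_cancel (b := ord.degree g'); rw [hr]; abel
  subst htr htr'
  have hlt' : t₂ + j ≺[ord] t₁ + i := by
    rw [add_assoc, add_assoc, map_add, map_add ord.toSyn r] at hlt
    exact lt_of_add_lt_add_left hlt
  rcases h.cover i g hg j g' hg' t₁ t₂ ht₁.symm ht₂.symm hlt' with
    ⟨i', g'', t', h1, h2, h3⟩ | ⟨s, hs, hs'⟩
  · refine hmin i' g'' (r + t') h1 (by rw [add_assoc, h2, add_assoc]) ?_
    rw [add_assoc, add_assoc, map_add, map_add ord.toSyn r]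
    gcongr
  · exact hS ⟨s, hs, hs'.trans (by rw [add_assoc]; exact le_add_self)⟩

/-- The signature of a pair `(a, w)` is cancelled by that of a multiple of an element of `G₁`. -/
theorem exists_cancel (h : IsCoveredBasis ord J F G₀ G₁ S) {a w : MvPolynomial ι k} (ha : a ≠ 0)
    (haw : w - a * F ∈ J) {i t : ι →₀ ℕ} {g : MvPolynomial ι k} (hg : (i, g) ∈ G₁)
    (ht : t + i = ord.degree a) :
    ∃ c ≠ 0, ∃ a₁, (w - monomial t c * g) - a₁ * F ∈ J ∧
      (a₁ = 0 ∨ ord.degree a₁ ≺[ord] ord.degree a) := by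
  obtain ⟨b, hb0, rfl, hb⟩ := h.lift i g hg
  have hlb : ord.leadingCoeff b ≠ 0 := ord.leadingCoeff_ne_zero_iff.2 hb0
  have hla : ord.leadingCoeff a ≠ 0 := ord.leadingCoeff_ne_zero_iff.2 ha
  refine ⟨ord.leadingCoeff a / ord.leadingCoeff b, div_ne_zero hla hlb,
    a - monomial t (ord.leadingCoeff a / ord.leadingCoeff b) * b, ?_,
    sub_monomial_mul_eq_zero_or_degree_lt ht.symm (div_mul_cancel₀ _ hlb).symm⟩
  have := J.sub_mem haw (J.mul_mem_left (monomial t (ord.leadingCoeff a / ord.leadingCoeff b)) hb)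
  convert this using 1
  ring

/-- A pair `(a, w)` with `w ≡ a F` modulo `J` and `w ≠ 0` is top-reducible, by an element of `G₀` or
by an element of `G₁` whose multiple has a signature not exceeding the one of the pair. -/
theorem top_reducible (h : IsCoveredBasis ord J F G₀ G₁ S) (a w : MvPolynomial ι k)
    (haw : w - a * F ∈ J) (hw : w ≠ 0) :
    (∃ g ∈ G₀, g ≠ 0 ∧ ord.degree g ≤ ord.degree w) ∨
      (a ≠ 0 ∧ ∃ i g t, (i, g) ∈ G₁ ∧ t + ord.degree g = ord.degree w ∧
        t + i ≼[ord] ord.degree a) := by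
  have base : ∀ w, w - 0 * F ∈ J → w ≠ 0 → ∃ g ∈ G₀, g ≠ 0 ∧ ord.degree g ≤ ord.degree w :=
    fun w hw h0 => h.exists_degree_le w (by simpa using hw) h0
  obtain ⟨d, hd⟩ : ∃ d, d = ord.toSyn (ord.degree a) := ⟨_, rfl⟩
  induction d using WellFoundedLT.induction generalizing a w with
  | ind d ih =>
  subst hd
  by_cases ha : a = 0
  · subst ha; exact Or.inl (base w haw hw)
  have next : ∀ a₁ w₁, w₁ - a₁ * F ∈ J → w₁ ≠ 0 →
      (a₁ = 0 ∨ ord.degree a₁ ≺[ord] ord.degree a) →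
      (∃ g ∈ G₀, g ≠ 0 ∧ ord.degree g ≤ ord.degree w₁) ∨
      (∃ i g t, (i, g) ∈ G₁ ∧ t + ord.degree g = ord.degree w₁ ∧
        t + i ≺[ord] ord.degree a) := by
    rintro a₁ w₁ h1 h2 (rfl | hlt)
    · exact Or.inl (base w₁ h1 h2)
    · rcases ih _ hlt a₁ w₁ h1 h2 rfl with h3 | ⟨_, i, g, t, h4, h5, h6⟩
      · exact Or.inl h3
      · exact Or.inr ⟨i, g, t, h4, h5, h6.trans_lt hlt⟩
  have weaken : ((∃ g ∈ G₀, g ≠ 0 ∧ ord.degree g ≤ ord.degree w) ∨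
      (∃ i g t, (i, g) ∈ G₁ ∧ t + ord.degree g = ord.degree w ∧
        t + i ≺[ord] ord.degree a)) →
      ((∃ g ∈ G₀, g ≠ 0 ∧ ord.degree g ≤ ord.degree w) ∨
      (a ≠ 0 ∧ ∃ i g t, (i, g) ∈ G₁ ∧ t + ord.degree g = ord.degree w ∧
        t + i ≼[ord] ord.degree a)) :=
    Or.imp_right fun ⟨i, g, t, h4, h5, h6⟩ => ⟨ha, i, g, t, h4, h5, h6.le⟩
  by_cases hS : ∃ s ∈ S, s ≤ ord.degree a
  · -- a syzygy lowers the signature without changing `w`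
    obtain ⟨s, hs, hsa⟩ := hS
    obtain ⟨b, hb0, rfl, hb⟩ := h.syzygy s hs
    obtain ⟨e, he⟩ := exists_add_of_le hsa
    rw [add_comm] at he
    have hlb : ord.leadingCoeff b ≠ 0 := ord.leadingCoeff_ne_zero_iff.2 hb0
    refine weaken (next (a - monomial e (ord.leadingCoeff a / ord.leadingCoeff b) * b) w ?_ hw
      (sub_monomial_mul_eq_zero_or_degree_lt he (div_mul_cancel₀ _ hlb).symm))
    have := J.add_mem haw (J.mul_mem_left (monomial e (ord.leadingCoeff a / ord.leadingCoeff b)) hb)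
    convert this using 1
    ring
  · obtain ⟨i, g, t, hg, hti, hmin⟩ := h.exists_minimal (ord.degree a)
    have hg0 := h.ne_zero i g hg
    obtain ⟨c, hc, a₁, h1, h2⟩ := h.exists_cancel ha haw hg hti
    have hdeg := degree_monomial_mul_eq (ord := ord) (e := t) hc hg0
    rw [← hti] at hmin hS
    rcases lt_trichotomy (ord.toSyn (ord.degree w)) (ord.toSyn (t + ord.degree g)) with
      hlt | heq | hgt
    · exfalso
      have hd1 : ord.degree (w - monomial t c * g) = t + ord.degree g := by
        rw [← neg_sub, ord.degree_neg, ord.degree_sub_of_lt (by rwa [hdeg]), hdeg]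
      have hne : w - monomial t c * g ≠ 0 := by
        intro h0
        rw [sub_eq_zero.1 h0, hdeg] at hlt
        exact lt_irrefl _ hlt
      rcases next _ _ h1 hne h2 with ⟨g', h3, h4, h5⟩ | ⟨j, g', t', h3, h4, h5⟩
      · exact h.not_le_of_minimal_bot hg hmin hS h3 h4 (hd1 ▸ h5)
      · exact h.not_lt_of_minimal hg hmin hS h3 (h4.trans hd1) (hti ▸ h5)
    · exact Or.inr ⟨ha, i, g, t, hg, (ord.toSyn.injective heq).symm, (congrArg _ hti).le⟩
    · have hd1 : ord.degree (w - monomial t c * g) = ord.degree w :=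
        ord.degree_sub_of_lt (by rwa [hdeg])
      have hne : w - monomial t c * g ≠ 0 := by
        intro h0
        rw [sub_eq_zero.1 h0, hdeg] at hgt
        exact lt_irrefl _ hgt
      have := next _ _ h1 hne h2
      rw [hd1] at this
      exact weaken this

/-- The leading monomials of the ideal `(J : F)` are divisible by elements of `S`. -/
theorem exists_le_degree_of_mul_mem (h : IsCoveredBasis ord J F G₀ G₁ S) {a : MvPolynomial ι k}
    (ha : a ≠ 0) (haF : a * F ∈ J) : ∃ s ∈ S, s ≤ ord.degree a := by
  by_contra hS
  obtain ⟨i, g, t, hg, hti, hmin⟩ := h.exists_minimal (ord.degree a)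
  have hg0 := h.ne_zero i g hg
  obtain ⟨c, hc, a₁, h1, h2⟩ := h.exists_cancel ha (w := 0) (by simpa using haF) hg hti
  have hdeg := degree_monomial_mul_eq (ord := ord) (e := t) hc hg0
  have hne : 0 - monomial t c * g ≠ 0 := by simp [hc, hg0]
  have hd1 : ord.degree (0 - monomial t c * g) = t + ord.degree g := by
    rw [zero_sub, ord.degree_neg, hdeg]
  have h4 := h.top_reducible _ _ h1 hne
  rw [← hti] at hmin hS h2
  rw [hd1] at h4
  rcases h4 with ⟨g', h3, h4, h5⟩ | ⟨h0, j, g', t', h3, h4, h5⟩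
  · exact h.not_le_of_minimal_bot hg hmin hS h3 h4 h5
  · exact h.not_lt_of_minimal hg hmin hS h3 h4 (h5.trans_lt (h2.resolve_left h0))

/-- The leading monomials of `J + (F)` are divisible by those of the elements of `G₀` and `G₁`. -/
theorem exists_degree_le_of_mem_sup (h : IsCoveredBasis ord J F G₀ G₁ S) {w : MvPolynomial ι k}
    (hw : w ∈ J ⊔ Ideal.span {F}) (h0 : w ≠ 0) :
    (∃ g ∈ G₀, g ≠ 0 ∧ ord.degree g ≤ ord.degree w) ∨
      ∃ i g, (i, g) ∈ G₁ ∧ ord.degree g ≤ ord.degree w := by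
  obtain ⟨x, hx, y, hy, rfl⟩ := Submodule.mem_sup.1 hw
  obtain ⟨a, rfl⟩ := Ideal.mem_span_singleton'.1 hy
  rcases h.top_reducible a _ (by simpa using hx) h0 with h1 | ⟨_, i, g, t, h1, h2, _⟩
  · exact Or.inl h1
  · exact Or.inr ⟨i, g, h1, h2 ▸ le_add_self⟩

end IsCoveredBasis

end CoverCriterion

/-! ### Divisibility by the uniformizer and the Gauss valuation -/

section GaussValuation

variable {K : Type*} [Field K] {v : AddValuation K (WithTop ℤ)} {n : ℕ}

theorem Uniformizer.ne_zero (π : Uniformizer v) : (π : K) ≠ 0 := by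
  intro h
  have := π.2
  rw [h, v.map_zero] at this
  exact WithTop.top_ne_coe this

theorem v_pow (π : Uniformizer v) (k : ℕ) : v ((π : K) ^ k) = ((k : ℤ) : WithTop ℤ) := by
  rw [← zpow_natCast, v_zpow]

/-- The uniformizer `π`, as a constant series. -/
noncomputable def unif (π : Uniformizer v) (n : ℕ) : IntSeries v n :=
  term ⟨π, by change 0 ≤ v (π : K); rw [π.2]; exact zero_le_one⟩ 0

theorem val_term (c : valRing v) (e : Fin n →₀ ℕ) :
    (term c e).1 = MvPowerSeries.monomial e (c : K) := rfl

theorem val_unif_mul (π : Uniformizer v) (f : IntSeries v n) :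
    (unif π n * f).1 = (π : K) • f.1 := by
  change MvPowerSeries.monomial 0 (π : K) * f.1 = _
  rw [MvPowerSeries.smul_eq_C_mul]
  rfl

theorem val_unif_pow_mul (π : Uniformizer v) (k : ℕ) (f : IntSeries v n) :
    (unif π n ^ k * f).1 = (π : K) ^ k • f.1 := by
  induction k generalizing f with
  | zero => simp
  | succ k ih => rw [pow_succ, mul_assoc, ih, val_unif_mul, smul_smul, pow_succ]

theorem coeff_unif_pow_mul (π : Uniformizer v) (k : ℕ) (f : IntSeries v n) (i : Fin n →₀ ℕ) :
    MvPowerSeries.coeff i (unif π n ^ k * f).1 = (π : K) ^ k * MvPowerSeries.coeff i f.1 := by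
  rw [val_unif_pow_mul, MvPowerSeries.coeff_smul]

theorem unif_pow_mul_cancel (π : Uniformizer v) (k : ℕ) {f g : IntSeries v n}
    (h : unif π n ^ k * f = unif π n ^ k * g) : f = g := by
  have h' := congrArg Subtype.val h
  rw [val_unif_pow_mul, val_unif_pow_mul] at h'
  exact Subtype.ext (smul_right_injective _ (pow_ne_zero k π.ne_zero) h')

theorem le_gval_iff {f : IntSeries v n} {c : WithTop ℤ} :
    c ≤ gval f ↔ ∀ i, c ≤ v (MvPowerSeries.coeff i f.1) := by
  constructor
  · intro h i
    exact h.trans ((gval_isLeast f).2 ⟨i, rfl⟩)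
  · intro h
    obtain ⟨i, hi⟩ := (gval_isLeast f).1
    exact (h i).trans_eq hi

theorem gval_le (f : IntSeries v n) (i : Fin n →₀ ℕ) :
    gval f ≤ v (MvPowerSeries.coeff i f.1) := le_gval_iff.1 le_rfl i

theorem gval_nonneg (f : IntSeries v n) : 0 ≤ gval f := le_gval_iff.2 f.2.1

theorem gval_eq_top_iff {f : IntSeries v n} : gval f = ⊤ ↔ f = 0 := by
  rw [← top_le_iff, le_gval_iff]
  constructor
  · intro h
    refine Subtype.ext (MvPowerSeries.ext fun i => ?_)
    simpa using h i
  · rintro rfl i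
    simp

/-- The Gauss valuation of a nonzero series, as a natural number (`0` for the zero series). -/
noncomputable def nval (f : IntSeries v n) : ℕ := ((gval f).untopD 0).toNat

theorem gval_eq_nval {f : IntSeries v n} (hf : f ≠ 0) : gval f = ((nval f : ℤ) : WithTop ℤ) := by
  obtain ⟨z, hz⟩ := WithTop.ne_top_iff_exists.1 (mt gval_eq_top_iff.1 hf)
  have h := gval_nonneg f
  rw [← hz] at h
  have h0 : 0 ≤ z := by exact_mod_cast h
  rw [nval, ← hz]
  simp [h0]

theorem nval_eq_of_gval_eq {f : IntSeries v n} {k : ℕ} (h : gval f = ((k : ℤ) : WithTop ℤ)) :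
    f ≠ 0 ∧ nval f = k := by
  have hf : f ≠ 0 := by
    rintro rfl
    rw [gval_eq_top_iff.2 rfl] at h
    exact WithTop.top_ne_coe h
  refine ⟨hf, ?_⟩
  rw [gval_eq_nval hf] at h
  exact_mod_cast h

theorem unif_pow_mul_nu (π : Uniformizer v) (f : IntSeries v n) :
    unif π n ^ nval f * nu π f = f := by
  by_cases hf : f = 0
  · subst hf
    apply Subtype.ext
    rw [val_unif_pow_mul]
    simp [nu]
  apply Subtype.ext
  rw [val_unif_pow_mul]
  change (π : K) ^ nval f • (π : K) ^ (-(gval f).untopD 0) • f.1 = f.1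
  rw [gval_eq_nval hf, WithTop.untopD_coe, smul_smul, zpow_neg, zpow_natCast,
    mul_inv_cancel₀ (pow_ne_zero _ π.ne_zero), one_smul]

theorem le_gval_iff_dvd (π : Uniformizer v) {f : IntSeries v n} {k : ℕ} :
    ((k : ℤ) : WithTop ℤ) ≤ gval f ↔ ∃ y, unif π n ^ k * y = f := by
  constructor
  · intro h
    by_cases hf : f = 0
    · exact ⟨0, by rw [hf, mul_zero]⟩
    rw [gval_eq_nval hf] at h
    have h : k ≤ nval f := by exact_mod_cast h
    refine ⟨unif π n ^ (nval f - k) * nu π f, ?_⟩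
    rw [← mul_assoc, ← pow_add, Nat.add_sub_cancel' h, unif_pow_mul_nu]
  · rintro ⟨y, rfl⟩
    rw [le_gval_iff]
    intro i
    rw [coeff_unif_pow_mul, v.map_mul, v_pow]
    exact le_add_of_nonneg_right (y.2.1 i)

theorem gval_unif_pow_mul (π : Uniformizer v) (k : ℕ) (f : IntSeries v n) :
    gval (unif π n ^ k * f) = ((k : ℤ) : WithTop ℤ) + gval f := by
  apply le_antisymm
  · obtain ⟨i, hi⟩ := (gval_isLeast f).1
    refine (gval_le _ i).trans_eq ?_
    rw [coeff_unif_pow_mul, v.map_mul, v_pow]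
    exact congrArg _ hi
  · rw [le_gval_iff]
    intro i
    rw [coeff_unif_pow_mul, v.map_mul, v_pow]
    gcongr
    exact gval_le f i

theorem nu_ne_zero (π : Uniformizer v) {f : IntSeries v n} (hf : f ≠ 0) : nu π f ≠ 0 := by
  intro h
  apply hf
  rw [← unif_pow_mul_nu π f, h, mul_zero]

theorem gval_nu (π : Uniformizer v) {f : IntSeries v n} (hf : f ≠ 0) : gval (nu π f) = 0 := by
  have h := gval_unif_pow_mul π (nval f) (nu π f)
  rw [unif_pow_mul_nu, gval_eq_nval hf, gval_eq_nval (nu_ne_zero π hf)] at h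
  have h : (nval f : ℤ) = nval f + nval (nu π f) := by exact_mod_cast h
  rw [gval_eq_nval (nu_ne_zero π hf)]
  have : (nval (nu π f) : ℤ) = 0 := by omega
  rw [this]; rfl

@[simp]
theorem nu_zero (π : Uniformizer v) : nu π (0 : IntSeries v n) = 0 :=
  Subtype.ext (smul_zero _)

theorem red_eq_zero_iff (π : Uniformizer v) {f : IntSeries v n} :
    red f = 0 ↔ ∃ y, unif π n * y = f := by
  have h1 := le_gval_iff_dvd π (f := f) (k := 1)
  rw [pow_one] at h1
  rw [← h1, le_gval_iff, MvPolynomial.ext_iff]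
  refine forall_congr' fun i => ?_
  change (redPoly f).coeff i = _ ↔ _
  rw [coeff_redPoly, MvPolynomial.coeff_zero, residue_eq_zero_iff]
  change 0 < v (MvPowerSeries.coeff i f.1) ↔ _
  cases v (MvPowerSeries.coeff i f.1) with
  | top => simp
  | coe a =>
    have : 0 < a ↔ ((1 : ℕ) : ℤ) ≤ a := by omega
    exact_mod_cast this

theorem red_unif (π : Uniformizer v) : red (unif π n) = 0 :=
  (red_eq_zero_iff π).2 ⟨1, mul_one _⟩

theorem red_unif_pow_mul (π : Uniformizer v) {k : ℕ} (hk : k ≠ 0) (f : IntSeries v n) :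
    red (unif π n ^ k * f) = 0 := by
  rw [map_mul, map_pow, red_unif, zero_pow hk, zero_mul]

theorem red_eq_zero_of_lt (π : Uniformizer v) {f : IntSeries v n} (h : 0 < gval f) : red f = 0 := by
  by_cases hf : f = 0
  · rw [hf, map_zero]
  rw [← unif_pow_mul_nu π f]
  rw [gval_eq_nval hf] at h
  have h : 0 < nval f := by exact_mod_cast h
  exact red_unif_pow_mul π h.ne' _

@[simp]
theorem rho_zero (π : Uniformizer v) : rho π (0 : IntSeries v n) = 0 := by
  rw [rho, nu_zero, map_zero]

theorem rho_ne_zero (π : Uniformizer v) {f : IntSeries v n} (hf : f ≠ 0) : rho π f ≠ 0 := by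
  intro h
  obtain ⟨y, hy⟩ := (red_eq_zero_iff π).1 h
  have h1 := (le_gval_iff_dvd π (k := 1)).2 ⟨y, by rw [pow_one]⟩
  rw [hy, gval_nu π hf] at h1
  exact absurd h1 (by decide)

theorem coeff_red (f : IntSeries v n) (i : Fin n →₀ ℕ) :
    (red f).coeff i = IsLocalRing.residue (valRing v) (intCoeff f i) := coeff_redPoly f i

theorem coeff_red_ne_zero_iff {f : IntSeries v n} {i : Fin n →₀ ℕ} :
    (red f).coeff i ≠ 0 ↔ v (MvPowerSeries.coeff i f.1) = 0 := by
  rw [coeff_red, Ne, residue_eq_zero_iff]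
  exact ⟨fun h => le_antisymm (not_lt.1 h) (f.2.1 i), fun h => h.not_gt⟩

theorem red_term (c : valRing v) (e : Fin n →₀ ℕ) :
    red (term c e) = MvPolynomial.monomial e (IsLocalRing.residue (valRing v) c) := by
  classical
  ext i
  rw [coeff_red, MvPolynomial.coeff_monomial]
  have : intCoeff (term c e) i = if e = i then c else 0 := by
    apply Subtype.ext
    change MvPowerSeries.coeff i (MvPowerSeries.monomial e (c : K)) = _
    rw [MvPowerSeries.coeff_monomial]
    simp only [eq_comm]
    split_ifs <;> rfl
  rw [this]; split_ifs <;> simp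

/-- A series `y` with `π^k y = f` and `red y ≠ 0` is the normalization of `f`. -/
theorem eq_nu_of_unif_pow_mul (π : Uniformizer v) {k : ℕ} {y f : IntSeries v n}
    (h : unif π n ^ k * y = f) (hy : red y ≠ 0) : y = nu π f ∧ nval f = k ∧ f ≠ 0 := by
  have hy0 : y ≠ 0 := by rintro rfl; exact hy (map_zero _)
  have hg : gval y = 0 := by
    refine le_antisymm (not_lt.1 fun h => hy (red_eq_zero_of_lt π h)) (gval_nonneg y)
  have h1 := gval_unif_pow_mul π k y
  rw [h, hg, add_zero] at h1
  obtain ⟨h2, h3⟩ := nval_eq_of_gval_eq h1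
  refine ⟨unif_pow_mul_cancel π k ?_, h3, h2⟩
  rw [h, ← h3, unif_pow_mul_nu]

theorem eq_nu_of_nval_eq (π : Uniformizer v) {y f : IntSeries v n}
    (h : unif π n ^ nval f * y = f) : y = nu π f :=
  unif_pow_mul_cancel π _ (h.trans (unif_pow_mul_nu π f).symm)

theorem le_nval_of_unif_pow_mul (π : Uniformizer v) {k : ℕ} {y f : IntSeries v n} (hf : f ≠ 0)
    (h : unif π n ^ k * y = f) : k ≤ nval f := by
  have h1 := (le_gval_iff_dvd π).2 ⟨y, h⟩
  rw [gval_eq_nval hf] at h1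
  exact_mod_cast h1

theorem mem_scaleSet_natCast (π : Uniformizer v) {N : ℕ} {A : Set (IntSeries v n)}
    {g : IntSeries v n} : g ∈ scaleSet π (N : ℤ) A ↔ ∃ f ∈ A, unif π n ^ N * f = g := by
  refine exists_congr fun f => and_congr_right fun _ => ?_
  rw [Subtype.ext_iff, val_unif_pow_mul, zpow_natCast]
  exact eq_comm

theorem mem_scaleSet_neg_natCast (π : Uniformizer v) {N : ℕ} {A : Set (IntSeries v n)}
    {g : IntSeries v n} : g ∈ scaleSet π (-(N : ℤ)) A ↔ unif π n ^ N * g ∈ A := by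
  have key : ∀ f : IntSeries v n, (g : MvPowerSeries (Fin n) K) = (π : K) ^ (-(N : ℤ)) •
      (f : MvPowerSeries (Fin n) K) ↔ unif π n ^ N * g = f := fun f => by
    rw [Subtype.ext_iff, val_unif_pow_mul, zpow_neg, zpow_natCast,
      eq_inv_smul_iff₀ (pow_ne_zero _ π.ne_zero)]
  constructor
  · rintro ⟨f, hf, h⟩
    rwa [(key f).1 h]
  · intro h
    exact ⟨_, h, (key _).2 rfl⟩

theorem mem_scaleIdeal_top_iff (π : Uniformizer v) {N : ℤ} {g : IntSeries v n} :
    g ∈ scaleIdeal π N (⊤ : Ideal (IntSeries v n)) ↔ (N : WithTop ℤ) ≤ gval g := by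
  change g ∈ scaleSet π N (Set.univ) ↔ _
  obtain ⟨m, rfl | rfl⟩ := N.eq_nat_or_neg
  · rw [mem_scaleSet_natCast, le_gval_iff_dvd π]
    simp
  · rw [mem_scaleSet_neg_natCast]
    refine iff_of_true trivial (le_trans ?_ (gval_nonneg g))
    exact_mod_cast (by omega : -(m : ℤ) ≤ 0)

end GaussValuation

/-! ### Leading monomials of series -/

section LeadingMonomials

variable {K : Type*} [Field K] {v : AddValuation K (WithTop ℤ)} {n : ℕ}
  {ord : MonomialOrder (Fin n)}

theorem sigLT_coe_iff {s t : TMon n} : sigLT ord (s : Sig n) (t : Sig n) ↔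
    t.1 < s.1 ∨ s.1 = t.1 ∧ ord.toSyn s.2 < ord.toSyn t.2 := by
  rw [sigLT, WithBot.map_coe, WithBot.map_coe, WithBot.coe_lt_coe, ordKey, ordKey,
    Prod.Lex.toLex_lt_toLex]
  simp

theorem bot_sigLT_coe (t : TMon n) : sigLT ord ⊥ (t : Sig n) := WithBot.bot_lt_coe _

theorem not_sigLT_bot (s : Sig n) : ¬ sigLT ord s ⊥ := not_lt_bot

theorem sigLT_irrefl (s : Sig n) : ¬ sigLT ord s s := lt_irrefl _

theorem sigLT.trans {s t u : Sig n} (h : sigLT ord s t) (h' : sigLT ord t u) : sigLT ord s u :=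
  lt_trans h h'

theorem sigLT.asymm {s t : Sig n} (h : sigLT ord s t) : ¬ sigLT ord t s := lt_asymm h

theorem v_eq_natVal {c : K} (hc : c ≠ 0) (h0 : 0 ≤ v c) :
    v c = ((natVal v c : ℤ) : WithTop ℤ) := by
  obtain ⟨z, hz⟩ := WithTop.ne_top_iff_exists.1 (v.ne_top_iff.2 hc)
  rw [natVal, ← hz]
  rw [← hz] at h0
  have h2 : 0 ≤ z := by exact_mod_cast h0
  simp [h2]

theorem natVal_eq_of_v_eq {c : K} {k : ℕ} (h : v c = ((k : ℤ) : WithTop ℤ)) : natVal v c = k := by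
  rw [natVal, h, WithTop.untopD_coe, Int.toNat_natCast]

theorem v_coeff_eq (π : Uniformizer v) (f : IntSeries v n) (i : Fin n →₀ ℕ) :
    v (MvPowerSeries.coeff i f.1) =
      ((nval f : ℤ) : WithTop ℤ) + v (MvPowerSeries.coeff i (nu π f).1) := by
  rw [← v_pow π, ← v.map_mul, ← coeff_unif_pow_mul, unif_pow_mul_nu]

theorem v_coeff_degree_rho (ord : MonomialOrder (Fin n)) (π : Uniformizer v) {f : IntSeries v n}
    (hf : f ≠ 0) :
    v (MvPowerSeries.coeff (ord.degree (rho π f)) f.1) = ((nval f : ℤ) : WithTop ℤ) := by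
  have h : v (MvPowerSeries.coeff (ord.degree (rho π f)) (nu π f).1) = 0 :=
    coeff_red_ne_zero_iff.1 ((ord.coeff_degree_ne_zero_iff).2 (rho_ne_zero π hf))
  rw [v_coeff_eq π, h, add_zero]

/-- The exponent of the leading term of a nonzero series `f` is the degree of `ρ(f)`. -/
theorem isLead_degree_rho (ord : MonomialOrder (Fin n)) (π : Uniformizer v) {f : IntSeries v n}
    (hf : f ≠ 0) : IsLead ord f (ord.degree (rho π f)) := by
  have hv := v_coeff_degree_rho ord π hf
  refine ⟨v.ne_top_iff.1 (by rw [hv]; exact WithTop.coe_ne_top), fun j hj => ?_⟩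
  rw [natVal_eq_of_v_eq hv]
  have h1 := gval_le f j
  rw [gval_eq_nval hf, v_eq_natVal hj (f.2.1 j)] at h1
  have h1 : nval f ≤ natVal v (MvPowerSeries.coeff j f.1) := by exact_mod_cast h1
  rw [ordKey, ordKey, Prod.Lex.toLex_le_toLex]
  rcases h1.lt_or_eq with h2 | h2
  · exact Or.inl h2
  · refine Or.inr ⟨congrArg OrderDual.toDual h2.symm, ord.le_degree ?_⟩
    rw [MvPolynomial.mem_support_iff]
    apply coeff_red_ne_zero_iff.2
    have h3 := v_eq_natVal hj (f.2.1 j)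
    rw [← h2, v_coeff_eq π] at h3
    dsimp only
    generalize v (MvPowerSeries.coeff j (nu π f).1) = x at h3
    cases x with
    | top => simp at h3
    | coe a =>
      have h3 : (nval f : ℤ) + a = nval f := by exact_mod_cast h3
      have : a = 0 := by omega
      rw [this]; rfl

theorem IsLead.ne_zero {f : IntSeries v n} {i : Fin n →₀ ℕ} (h : IsLead ord f i) : f ≠ 0 := by
  rintro rfl
  exact h.1 (by simp)

theorem IsLead.eq_degree_rho (π : Uniformizer v) {f : IntSeries v n} {i : Fin n →₀ ℕ}
    (h : IsLead ord f i) : i = ord.degree (rho π f) :=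
  h.unique (isLead_degree_rho ord π h.ne_zero)

theorem LM_eq (π : Uniformizer v) {f : IntSeries v n} (hf : f ≠ 0) :
    LM ord f = ((nval f, ord.degree (rho π f)) : TMon n) := by
  have h : ∃ i, IsLead ord f i := exists_isLead ord hf
  rw [LM, dif_pos h, h.choose_spec.eq_degree_rho π,
    natVal_eq_of_v_eq (v_coeff_degree_rho ord π hf)]

theorem LM_zero : LM ord (0 : IntSeries v n) = ⊥ :=
  dif_neg fun ⟨_, h⟩ => h.ne_zero rfl

theorem LM_eq_coe_iff (π : Uniformizer v) {f : IntSeries v n} {s : TMon n} :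
    LM ord f = s ↔ f ≠ 0 ∧ s = (nval f, ord.degree (rho π f)) := by
  by_cases hf : f = 0
  · subst hf
    simp [LM_zero]
  · rw [LM_eq π hf, WithBot.coe_inj]
    exact ⟨fun h => ⟨hf, h.symm⟩, fun h => h.2.symm⟩

theorem term_eq_unif_pow_mul (π : Uniformizer v) {k : ℕ} {c c₀ : valRing v}
    (h : (c : K) = (π : K) ^ k * c₀) (e : Fin n →₀ ℕ) :
    (term c e : IntSeries v n) = unif π n ^ k * term c₀ e := by
  apply Subtype.ext
  rw [val_unif_pow_mul, val_term, val_term, h, ← smul_eq_mul, map_smul]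

/-- Multiplying by the monomial `π^a X^e`. -/
theorem mulPair_snd (π : Uniformizer v) (t : TMon n) (p : SPair v n) :
    (mulPair π t p).2 = unif π n ^ t.1 * (term 1 t.2 * p.2) := by
  rw [mulPair, ← mul_assoc]
  refine congrArg (· * p.2) (term_eq_unif_pow_mul π ?_ _)
  exact (mul_one _).symm

theorem red_term_one (e : Fin n →₀ ℕ) :
    red (term 1 e : IntSeries v n) = MvPolynomial.monomial e 1 := by
  rw [red_term, map_one]

/-- Normalization is compatible with multiplication by `π^k X^e`. -/
theorem nu_unif_pow_mul_term_mul (π : Uniformizer v) (k : ℕ) (e : Fin n →₀ ℕ)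
    {f : IntSeries v n} (hf : f ≠ 0) :
    term 1 e * nu π f = nu π (unif π n ^ k * (term 1 e * f)) ∧
      nval (unif π n ^ k * (term 1 e * f)) = k + nval f ∧
      unif π n ^ k * (term 1 e * f) ≠ 0 := by
  apply eq_nu_of_unif_pow_mul
  · conv_rhs => rw [← unif_pow_mul_nu π f]
    ring
  · rw [map_mul, red_term_one]
    exact mul_ne_zero (by simp) (rho_ne_zero π hf)

theorem LM_mulPair_snd (π : Uniformizer v) (t : TMon n) (p : SPair v n) :
    LM ord (mulPair π t p).2 = (t : Sig n) + LM ord p.2 := by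
  rw [mulPair_snd]
  by_cases hp : p.2 = 0
  · rw [hp, mul_zero, mul_zero, LM_zero]; rfl
  obtain ⟨h1, h2, h3⟩ := nu_unif_pow_mul_term_mul π t.1 t.2 hp
  rw [LM_eq π h3, LM_eq π hp, ← WithBot.coe_add, h2]
  have h4 : rho π (unif π n ^ t.1 * (term 1 t.2 * p.2)) =
      MvPolynomial.monomial t.2 1 * rho π p.2 := by
    rw [rho, ← h1, map_mul, red_term_one]; rfl
  rw [h4, degree_monomial_mul_eq one_ne_zero (rho_ne_zero π hp)]
  rfl

end LeadingMonomials

/-! ### Regular top-reductions and J-pairs -/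

section Reduction

variable {K : Type*} [Field K] {v : AddValuation K (WithTop ℤ)} {n : ℕ}
  {ord : MonomialOrder (Fin n)}

/-- A regular top-reduction of `w`, in terms of normalized series: it subtracts from `ν(w)` a
multiple `c X^e ν(q)`, where `c` is a unit of `K°`, so as to cancel the leading term of `ρ(w)`. -/
theorem RegStep.exists_sub (π : Uniformizer v) {G : Set (SPair v n)} {u : Sig n}
    {w w' : IntSeries v n} (h : RegStep ord G u w w') :
    w ≠ 0 ∧ ∃ q ∈ G, q.2 ≠ 0 ∧ ∃ (e : Fin n →₀ ℕ) (c : valRing v) (k : ℕ),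
      nval w = k + nval q.2 ∧ ord.degree (rho π w) = e + ord.degree (rho π q.2) ∧
      ord.leadingCoeff (rho π w) =
        IsLocalRing.residue (valRing v) c * ord.leadingCoeff (rho π q.2) ∧
      sigLT ord (((k, e) : TMon n) + q.1) u ∧
      w' = unif π n ^ nval w * (nu π w - term c e * nu π q.2) := by
  obtain ⟨q, hq, i, j, e, c, hi, hj, hij, hc, hsig, rfl⟩ := h
  have hw := hi.ne_zero
  have hq0 := hj.ne_zero
  have hi' := hi.eq_degree_rho π
  have hj' := hj.eq_degree_rho π
  have hc0 : (c : K) ≠ 0 := by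
    intro h0; exact hi.1 (by rw [hc, h0, zero_mul])
  have hval : nval w = natVal v (c : K) + nval q.2 := by
    have h1 := congrArg v hc
    rw [v.map_mul, hi', hj', v_coeff_degree_rho ord π hw, v_coeff_degree_rho ord π hq0,
      v_eq_natVal hc0 c.2] at h1
    exact_mod_cast h1
  set k := natVal v (c : K) with hk
  -- `c = π^k c₀` for a unit `c₀`
  have hv0 : 0 ≤ v ((c : K) * (π : K) ^ (-(k : ℤ))) := by
    rw [v.map_mul, v_zpow, v_eq_natVal hc0 c.2, ← hk]
    exact_mod_cast (by omega : (0 : ℤ) ≤ (k : ℤ) + -(k : ℤ))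
  obtain ⟨c₀, hc₀⟩ : ∃ c₀ : valRing v, (c : K) = (π : K) ^ k * c₀ := by
    refine ⟨⟨_, hv0⟩, ?_⟩
    change (c : K) = (π : K) ^ k * ((c : K) * (π : K) ^ (-(k : ℤ)))
    rw [zpow_neg, zpow_natCast]
    field_simp [π.ne_zero]
  refine ⟨hw, q, hq, hq0, e, c₀, k, hval, ?_, ?_, hsig, ?_⟩
  · rw [← hi', ← hj', hij]
  · rw [MonomialOrder.leadingCoeff, MonomialOrder.leadingCoeff, ← hi', ← hj', rho, rho, coeff_red,
      coeff_red, ← map_mul]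
    congr 1
    apply Subtype.ext
    change MvPowerSeries.coeff i (nu π w).1 = (c₀ : K) * MvPowerSeries.coeff j (nu π q.2).1
    conv_lhs at hc => rw [← unif_pow_mul_nu π w, coeff_unif_pow_mul, hval]
    conv_rhs at hc => rw [← unif_pow_mul_nu π q.2, coeff_unif_pow_mul, hc₀]
    apply mul_left_cancel₀ (pow_ne_zero (k + nval q.2) π.ne_zero)
    rw [hc]
    ring
  · conv_lhs => rw [← unif_pow_mul_nu π w, ← unif_pow_mul_nu π q.2,
      term_eq_unif_pow_mul π hc₀]
    rw [mul_sub]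
    congr 1
    rw [hval]
    ring

/-- A regular top-reduction lowers the leading monomial. -/
theorem RegStep.LM_lt (π : Uniformizer v) {G : Set (SPair v n)} {u : Sig n}
    {w w' : IntSeries v n} (h : RegStep ord G u w w') : sigLT ord (LM ord w') (LM ord w) := by
  obtain ⟨hw, q, hq, hq0, e, c, k, hk, hd, hc, hsig, rfl⟩ := h.exists_sub π
  rw [LM_eq π hw]
  set y := nu π w - term c e * nu π q.2 with hy
  by_cases h0 : unif π n ^ nval w * y = 0
  · rw [h0, LM_zero]; exact bot_sigLT_coe _
  rw [LM_eq π h0, sigLT_coe_iff]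
  have hle : nval w ≤ nval (unif π n ^ nval w * y) := le_nval_of_unif_pow_mul π h0 rfl
  rcases hle.lt_or_eq with hlt | heq
  · exact Or.inl hlt
  refine Or.inr ⟨heq.symm, ?_⟩
  have hny : y = nu π (unif π n ^ nval w * y) := eq_nu_of_nval_eq π (by rw [← heq])
  have hred : red y = rho π w - MvPolynomial.monomial e (IsLocalRing.residue (valRing v) c) *
      rho π q.2 := by
    rw [hy, map_sub, map_mul, red_term]; rfl
  have hrho : rho π (unif π n ^ nval w * y) = red y := by rw [rho, ← hny]
  rcases sub_monomial_mul_eq_zero_or_degree_lt hd hc with h1 | h1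
  · exact absurd (hrho.trans (hred.trans h1)) (rho_ne_zero π h0)
  · rw [hrho, hred]; exact h1

theorem LM_lt_or_eq_of_reflTransGen (π : Uniformizer v) {G : Set (SPair v n)} {u : Sig n}
    {w w' : IntSeries v n} (h : Relation.ReflTransGen (RegStep ord G u) w w') :
    w' = w ∨ sigLT ord (LM ord w') (LM ord w) := by
  induction h with
  | refl => exact Or.inl rfl
  | tail _ h ih =>
    right
    rcases ih with rfl | ih
    · exact h.LM_lt π
    · exact (h.LM_lt π).trans ih

/-- A series whose leading monomial is a multiple of that of an element of `G`, at a higher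
signature, has a regular top-reduction. -/
theorem exists_regStep (π : Uniformizer v) {G : Set (SPair v n)} {u : Sig n}
    {w : IntSeries v n} {q : SPair v n} (hq : q ∈ G) {s t : TMon n} (hs : LM ord q.2 = s)
    (hw : LM ord w = (t + s : TMon n)) (hsig : sigLT ord (t + q.1) u) :
    ∃ w', RegStep ord G u w w' := by
  obtain ⟨hq0, rfl⟩ := (LM_eq_coe_iff π).1 hs
  obtain ⟨hw0, hts⟩ := (LM_eq_coe_iff π).1 hw
  obtain ⟨k, e⟩ := t
  obtain ⟨h1, h2⟩ := Prod.mk.inj hts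
  dsimp only at h1 h2
  have hi := isLead_degree_rho ord π hw0
  have hj := isLead_degree_rho ord π hq0
  set a := MvPowerSeries.coeff (ord.degree (rho π w)) w.1 with ha
  set b := MvPowerSeries.coeff (ord.degree (rho π q.2)) q.2.1 with hb
  have hva : v a = ((nval w : ℤ) : WithTop ℤ) := v_coeff_degree_rho ord π hw0
  have hvb : v b = ((nval q.2 : ℤ) : WithTop ℤ) := v_coeff_degree_rho ord π hq0
  have hb0 : b ≠ 0 := hj.1
  have hvc : v (a / b) = ((k : ℤ) : WithTop ℤ) := by
    have h3 : v (a / b) + v b = v a := by rw [← v.map_mul, div_mul_cancel₀ _ hb0]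
    rw [hva, hvb, ← h1] at h3
    generalize v (a / b) = x at h3
    cases x with
    | top => rw [top_add] at h3; exact absurd h3 WithTop.top_ne_coe
    | coe z =>
      have h3 : z + (nval q.2 : ℤ) = ((k + nval q.2 : ℕ) : ℤ) := by exact_mod_cast h3
      have : z = k := by omega
      rw [this]
  refine ⟨_, q, hq, _, _, e, ⟨a / b, ?_⟩, hi, hj, h2.symm, ?_, ?_, rfl⟩
  · change 0 ≤ v (a / b)
    rw [hvc]
    exact_mod_cast Int.natCast_nonneg k
  · exact (div_mul_cancel₀ _ hb0).symm
  · rw [natVal_eq_of_v_eq hvc]; exact hsig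

theorem IsJPair.symm {π : Uniformizer v} {p₁ p₂ p : SPair v n} (h : IsJPair ord π p₁ p₂ p) :
    IsJPair ord π p₂ p₁ p := by
  obtain ⟨s₁, s₂, t₁, t₂, h1, h2, h3, h4, h5⟩ := h
  exact ⟨s₂, s₁, t₂, t₁, h2, h1, by rw [h4, sup_comm], by rw [h3, sup_comm], h5.symm⟩

theorem not_isJPair_self {π : Uniformizer v} {p q : SPair v n} : ¬ IsJPair ord π p p q := by
  rintro ⟨s₁, s₂, t₁, t₂, h1, h2, h3, h4, h5⟩
  obtain rfl : s₁ = s₂ := WithBot.coe_injective (h1.symm.trans h2)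
  obtain rfl : t₁ = t₂ := add_right_cancel (h3.trans h4.symm)
  rcases h5 with h5 | h5 <;> exact sigLT_irrefl _ h5.1

/-- A J-pair is a multiple of one of the two pairs, and has a regular top-reduction by the other. -/
theorem IsJPair.exists_mulPair {π : Uniformizer v} {p₁ p₂ p : SPair v n}
    (h : IsJPair ord π p₁ p₂ p) :
    ∃ q q' t t' s s', (q = p₁ ∧ q' = p₂ ∨ q = p₂ ∧ q' = p₁) ∧ p = mulPair π t q ∧
      LM ord q.2 = (s : TMon n) ∧ LM ord q'.2 = (s' : TMon n) ∧ t + s = s ⊔ s' ∧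
      t' + s' = s ⊔ s' ∧ sigLT ord (t' + q'.1) p.1 := by
  obtain ⟨s₁, s₂, t₁, t₂, h1, h2, h3, h4, ⟨h5, rfl⟩ | ⟨h5, rfl⟩⟩ := h
  · exact ⟨p₂, p₁, t₂, t₁, s₂, s₁, Or.inr ⟨rfl, rfl⟩, rfl, h2, h1, by rw [h4, sup_comm],
      by rw [h3, sup_comm], h5⟩
  · exact ⟨p₁, p₂, t₁, t₂, s₁, s₂, Or.inl ⟨rfl, rfl⟩, rfl, h1, h2, h3, h4, h5⟩

theorem IsJPair.exists_regStep {π : Uniformizer v} {G : Set (SPair v n)} {p₁ p₂ p : SPair v n}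
    (h : IsJPair ord π p₁ p₂ p) (h₁ : p₁ ∈ G) (h₂ : p₂ ∈ G) :
    ∃ w', RegStep ord G p.1 p.2 w' := by
  obtain ⟨q, q', t, t', s, s', hq, rfl, hs, hs', ht, ht', hsig⟩ := h.exists_mulPair
  have hq' : q' ∈ G := by rcases hq with ⟨_, rfl⟩ | ⟨_, rfl⟩ <;> assumption
  refine Tate.exists_regStep π hq' hs' ?_ hsig
  rw [LM_mulPair_snd, hs, ← WithBot.coe_add, ht, ht']

theorem finite_setOf_isJPair (ord : MonomialOrder (Fin n)) (π : Uniformizer v)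
    (p₁ p₂ : SPair v n) : {p | IsJPair ord π p₁ p₂ p}.Finite := by
  refine Set.Subsingleton.finite ?_
  rintro p ⟨s₁, s₂, t₁, t₂, h1, h2, h3, h4, h5⟩ p' ⟨s₁', s₂', t₁', t₂', h1', h2', h3', h4', h5'⟩
  obtain rfl : s₁ = s₁' := WithBot.coe_injective (h1.symm.trans h1')
  obtain rfl : s₂ = s₂' := WithBot.coe_injective (h2.symm.trans h2')
  obtain rfl : t₁ = t₁' := add_right_cancel (h3.trans h3'.symm)
  obtain rfl : t₂ = t₂' := add_right_cancel (h4.trans h4'.symm)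
  rcases h5 with ⟨h5, rfl⟩ | ⟨h5, rfl⟩ <;> rcases h5' with ⟨h5', rfl⟩ | ⟨h5', rfl⟩
  · rfl
  · exact absurd h5' h5.asymm
  · exact absurd h5' h5.asymm
  · rfl

theorem RegStep.mono {G G' : Set (SPair v n)} (hG : G ⊆ G') {u : Sig n} {w w' : IntSeries v n}
    (h : RegStep ord G u w w') : RegStep ord G' u w w' := by
  obtain ⟨q, hq, h⟩ := h
  exact ⟨q, hG hq, h⟩

theorem IsCovered.mono {G G' : Set (SPair v n)} (hG : G ⊆ G') {p : SPair v n}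
    (h : IsCovered ord G p) : IsCovered ord G' p := by
  obtain ⟨q, hq, h⟩ := h
  exact ⟨q, hG hq, h⟩

theorem IsDivisible.mono {S S' : Set (TMon n)} (hS : S ⊆ S') {u : Sig n} (h : IsDivisible S u) :
    IsDivisible S' u := by
  obtain ⟨s, hs, h⟩ := h
  exact ⟨s, hS hs, h⟩

/-- A series with a regular top-reduction loses its leading term in `regular_reduce`. -/
theorem RegularReduce.LM_lt (π : Uniformizer v) {G : Set (SPair v n)} {u : Sig n}
    {w w' : IntSeries v n} (h : RegularReduce ord G u w w')
    (hw : ∃ w'', RegStep ord G u w w'') : sigLT ord (LM ord w') (LM ord w) := by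
  rcases LM_lt_or_eq_of_reflTransGen π h.1 with rfl | h1
  · rcases h.2 with h2 | h2
    · exact absurd hw.choose_spec (h2 _)
    · exact absurd h2 (lt_irrefl _)
  · exact h1

end Reduction

/-! ### Invariants of the loops -/

section Invariants

variable {K : Type*} [Field K] {v : AddValuation K (WithTop ℤ)} {n : ℕ}

/-- The ideal generated by the normalizations of the elements of `D`. -/
noncomputable def nuIdeal (π : Uniformizer v) (D : Set (IntSeries v n)) : Ideal (IntSeries v n) :=
  Ideal.span (nu π '' D)

/-- The series `π^(-val(d)) w`, where `d ∈ D` and where `w ∈ W` has a larger valuation than `d`.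
They are all divisible by `π`. -/
def raisedSet (π : Uniformizer v) (D W : Set (IntSeries v n)) : Set (IntSeries v n) :=
  {e | ∃ d ∈ D, ∃ w ∈ W, gval d < gval w ∧ unif π n ^ nval d * e = w}

theorem raisedSet_mono (π : Uniformizer v) {D D' W W' : Set (IntSeries v n)} (hD : D ⊆ D')
    (hW : W ⊆ W') : raisedSet π D W ⊆ raisedSet π D' W' :=
  fun _ ⟨d, hd, w, hw, h⟩ => ⟨d, hD hd, w, hW hw, h⟩

theorem nuIdeal_mono (π : Uniformizer v) {D D' : Set (IntSeries v n)} (hD : D ⊆ D') :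
    nuIdeal π D ≤ nuIdeal π D' := Ideal.span_mono (Set.image_mono hD)

theorem red_eq_zero_of_mem_raisedSet (π : Uniformizer v) {D W : Set (IntSeries v n)}
    {e : IntSeries v n} (he : e ∈ raisedSet π D W) : red e = 0 := by
  obtain ⟨d, _, w, _, hlt, rfl⟩ := he
  have hd : d ≠ 0 := by
    rintro rfl
    rw [gval_eq_top_iff.2 rfl] at hlt
    exact not_top_lt hlt
  apply red_eq_zero_of_lt π
  rw [gval_unif_pow_mul, gval_eq_nval hd] at hlt
  by_contra h
  rw [le_antisymm (not_lt.1 h) (gval_nonneg e), add_zero] at hlt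
  exact lt_irrefl _ hlt

theorem red_eq_zero_of_mem_span_raisedSet (π : Uniformizer v) {D W : Set (IntSeries v n)}
    {e : IntSeries v n} (he : e ∈ Ideal.span (raisedSet π D W)) : red e = 0 := by
  have : Ideal.span (raisedSet π D W) ≤ RingHom.ker red :=
    Ideal.span_le.2 fun e he => red_eq_zero_of_mem_raisedSet π he
  exact this he

theorem map_red_nuIdeal (π : Uniformizer v) (D : Set (IntSeries v n)) :
    (nuIdeal π D).map red = Ideal.span (rho π '' D) := by
  rw [nuIdeal, Ideal.map_span, Set.image_image]
  rfl

theorem red_mem_of_mem_nuIdeal (π : Uniformizer v) {D : Set (IntSeries v n)}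
    {h : IntSeries v n} (hh : h ∈ nuIdeal π D) : red h ∈ Ideal.span (rho π '' D) := by
  rw [← map_red_nuIdeal]
  exact Ideal.mem_map_of_mem _ hh

/-- The normalization by `π^(-val(f))` of the series `w` is congruent to `b ν(f)` modulo the
ideal `H`, where `b` is a series whose reduction has the leading monomial `X^i`. -/
def HasLift (ord : MonomialOrder (Fin n)) (π : Uniformizer v) (H : Ideal (IntSeries v n))
    (f : IntSeries v n) (i : Fin n →₀ ℕ) (w : IntSeries v n) : Prop :=
  ∃ y b, unif π n ^ nval f * y = w ∧ y - b * nu π f ∈ H ∧ red b ≠ 0 ∧ ord.degree (red b) = i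

/-- The pair `p` has the signature `X^i`, the same valuation as `f`, and a lift witnessing its
signature. -/
def HasSig (ord : MonomialOrder (Fin n)) (π : Uniformizer v) (H : Ideal (IntSeries v n))
    (f : IntSeries v n) (i : Fin n →₀ ℕ) (p : SPair v n) : Prop :=
  p.1 = ((0, i) : TMon n) ∧ gval p.2 = gval f ∧ HasLift ord π H f i p.2

variable {ord : MonomialOrder (Fin n)} {π : Uniformizer v} {H : Ideal (IntSeries v n)}
  {f : IntSeries v n} {G : Set (SPair v n)}

/-- Regular top-reductions preserve the lift of the signature. -/
theorem HasLift.regStep (hG : ∀ p ∈ G, (p.1 = ⊥ ∧ nu π p.2 ∈ H ∧ gval p.2 ≤ gval f) ∨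
      ∃ i, HasSig ord π H f i p) {i : Fin n →₀ ℕ} {w w' : IntSeries v n}
    (hw : HasLift ord π H f i w) (h : RegStep ord G ((0, i) : TMon n) w w') :
    HasLift ord π H f i w' := by
  obtain ⟨y, b, hy, hyb, hb0, hbi⟩ := hw
  obtain ⟨hw0, q, hq, hq0, e, c, k, hk, -, -, hsig, rfl⟩ := h.exists_sub π
  obtain ⟨l, hl⟩ := Nat.exists_eq_add_of_le (le_nval_of_unif_pow_mul π hw0 hy)
  have hyl : y = unif π n ^ l * nu π w := by
    apply unif_pow_mul_cancel π (nval f)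
    rw [hy, ← mul_assoc, ← pow_add, ← hl, unif_pow_mul_nu]
  rcases hG q hq with ⟨_, hqH, _⟩ | ⟨j, hqj, hqf, y', b', hy', hyb', hb0', hbj'⟩
  · refine ⟨unif π n ^ l * (nu π w - term c e * nu π q.2), b, ?_, ?_, hb0, hbi⟩
    · rw [← mul_assoc, ← pow_add, ← hl]
    · have := H.sub_mem hyb (H.mul_mem_left (unif π n ^ l * term c e) hqH)
      rw [hyl] at this
      convert this using 1
      ring
  · have hf0 : f ≠ 0 := by
      rintro rfl
      rw [gval_eq_top_iff.2 rfl, gval_eq_top_iff] at hqf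
      exact hq0 hqf
    have hqf' : nval q.2 = nval f := by rw [nval, nval, hqf]
    have hy'' : y' = nu π q.2 := eq_nu_of_nval_eq π (by rw [hqf']; exact hy')
    rw [hy''] at hyb'
    have hkl : k = l := by omega
    subst hkl
    refine ⟨unif π n ^ k * (nu π w - term c e * nu π q.2),
      b - unif π n ^ k * (term c e * b'), ?_, ?_, ?_⟩
    · rw [← mul_assoc, ← pow_add, ← hl]
    · have := H.sub_mem hyb (H.mul_mem_left (unif π n ^ k * term c e) hyb')
      rw [hyl] at this
      convert this using 1
      ring
    · rcases Nat.eq_zero_or_pos k with rfl | hk0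
      · -- the subtracted signature `X^e X^j` is smaller than `X^i`
        have hlt : ord.toSyn (e + j) < ord.toSyn i := by
          rw [hqj, ← WithBot.coe_add, sigLT_coe_iff] at hsig
          rcases hsig with h | h
          · exact absurd h (by simp)
          · exact h.2
        have hlt' : ord.toSyn (ord.degree (red (term c e * b'))) <
            ord.toSyn (ord.degree (red b)) := by
          rw [map_mul, red_term, hbi]
          refine lt_of_le_of_lt (ord.degree_mul_le.trans ?_) hlt
          rw [map_add, map_add, hbj']
          gcongr
          exact ord.degree_monomial_le _
        rw [pow_zero, one_mul, map_sub]
        have hd := ord.degree_sub_of_lt hlt'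
        refine ⟨fun h0 => ?_, hd.trans hbi⟩
        rw [sub_eq_zero.1 h0] at hlt'
        exact lt_irrefl _ hlt'
      · rw [map_sub, red_unif_pow_mul π hk0.ne', sub_zero]
        exact ⟨hb0, hbi⟩

theorem HasLift.reflTransGen (hG : ∀ p ∈ G, (p.1 = ⊥ ∧ nu π p.2 ∈ H ∧ gval p.2 ≤ gval f) ∨
      ∃ i, HasSig ord π H f i p) {i : Fin n →₀ ℕ} {w w' : IntSeries v n}
    (hw : HasLift ord π H f i w)
    (h : Relation.ReflTransGen (RegStep ord G ((0, i) : TMon n)) w w') :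
    HasLift ord π H f i w' := by
  induction h with
  | refl => exact hw
  | tail _ h ih => exact ih.regStep hG h

theorem HasLift.le_gval {i : Fin n →₀ ℕ} {w : IntSeries v n} (hf : f ≠ 0)
    (h : HasLift ord π H f i w) : gval f ≤ gval w := by
  obtain ⟨y, b, hy, _⟩ := h
  rw [gval_eq_nval hf]
  exact (le_gval_iff_dvd π).2 ⟨y, hy⟩

/-- The J-pairs of elements of `G` have signatures of the form `X^i` and the valuation of `f`,
because the valuations of the elements of `G` do not exceed that of `f`. -/
theorem IsJPair.hasSig (hG : ∀ p ∈ G, (p.1 = ⊥ ∧ nu π p.2 ∈ H ∧ gval p.2 ≤ gval f) ∨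
      ∃ i, HasSig ord π H f i p) {p₁ p₂ p : SPair v n} (h₁ : p₁ ∈ G) (h₂ : p₂ ∈ G)
    (h : IsJPair ord π p₁ p₂ p) : f ≠ 0 ∧ ∃ i, HasSig ord π H f i p := by
  obtain ⟨q, q', t, t', s, s', hq, rfl, hs, hs', ht, ht', hsig⟩ := h.exists_mulPair
  have hqG : q ∈ G := by rcases hq with ⟨rfl, _⟩ | ⟨rfl, _⟩ <;> assumption
  have hqG' : q' ∈ G := by rcases hq with ⟨_, rfl⟩ | ⟨_, rfl⟩ <;> assumption
  obtain ⟨hq0, rfl⟩ := (LM_eq_coe_iff π).1 hs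
  obtain ⟨hq0', rfl⟩ := (LM_eq_coe_iff π).1 hs'
  rcases hG q hqG with ⟨hbot, _⟩ | ⟨j, hqj, hqf, y, b, hy, hyb, hb0, hbj⟩
  · rw [mulPair, hbot, WithBot.add_bot] at hsig
    exact absurd hsig (not_sigLT_bot _)
  have hf0 : f ≠ 0 := by
    rintro rfl
    rw [gval_eq_top_iff.2 rfl, gval_eq_top_iff] at hqf
    exact hq0 hqf
  have hle : gval q'.2 ≤ gval f := by
    rcases hG q' hqG' with ⟨_, _, h⟩ | ⟨_, _, h, _⟩
    · exact h
    · exact h.le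
  have hle' : nval q'.2 ≤ nval q.2 := by
    rw [← hqf, gval_eq_nval hq0, gval_eq_nval hq0'] at hle
    exact_mod_cast hle
  obtain ⟨t₁, t₂⟩ := t
  have ht1 : t₁ = 0 := by
    have := congrArg Prod.fst ht
    simp only [Prod.fst_add, Prod.fst_sup, sup_eq_left.2 hle'] at this
    omega
  subst ht1
  refine ⟨hf0, t₂ + j, ?_, ?_, term 1 t₂ * y, term 1 t₂ * b, ?_, ?_, ?_, ?_⟩
  · rw [mulPair, hqj, ← WithBot.coe_add]; rfl
  · obtain ⟨-, h2, h3⟩ := nu_unif_pow_mul_term_mul π 0 t₂ hq0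
    rw [mulPair_snd, gval_eq_nval h3, h2, zero_add, ← gval_eq_nval hq0, hqf]
  · rw [mulPair_snd, ← hy]; ring
  · have := H.mul_mem_left (term 1 t₂) hyb
    convert this using 1
    ring
  · rw [map_mul, red_term_one]
    exact mul_ne_zero (by simp) hb0
  · rw [map_mul, red_term_one, degree_monomial_mul_eq one_ne_zero hb0, hbj]

/-- The invariant at the head of the main loop, where `D` is the set of the series popped so far.
The last field says that the syzygies of `ρ(D)` lift: an element of the ideal `⟨ν(D)⟩` divisible by
`π` is the sum of an element of `π ⟨ν(D)⟩` and of a combination of the series found when the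
valuation rose. -/
structure OuterInv (ord : MonomialOrder (Fin n)) (π : Uniformizer v) (D : Set (IntSeries v n))
    (Q : Multiset (IntSeries v n)) (GB : Set (IntSeries v n)) : Prop where
  finite_basis : GB.Finite
  groebner : IsGroebnerBasis ord (rho π '' GB) (Ideal.span (rho π '' D))
  nu_mem : ∀ g ∈ GB, nu π g ∈ nuIdeal π D
  popped_le : ∀ d ∈ D, ∀ q ∈ Q, gval d ≤ gval q
  basis_le : ∀ g ∈ GB, ∀ q ∈ Q, gval g ≤ gval q
  lift_syzygy : ∀ h ∈ nuIdeal π D, red h = 0 → ∃ z ∈ nuIdeal π D,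
    h - unif π n * z ∈ Ideal.span (raisedSet π D (D ∪ {q | q ∈ Q}))

/-- The invariant at the head of the inner loop, where `D` is the set of the series popped before
`f`, and where `GB` is the value of `GBasis` when `f` was popped. -/
structure InnerInv (ord : MonomialOrder (Fin n)) (π : Uniformizer v) (D GB : Set (IntSeries v n))
    (Q : Multiset (IntSeries v n)) (f : IntSeries v n) (G : Set (SPair v n)) (S : Set (TMon n))
    (B : Set (SPair v n)) : Prop where
  finite_basis : GB.Finite
  groebner : IsGroebnerBasis ord (rho π '' GB) (Ideal.span (rho π '' D))
  nu_mem : ∀ g ∈ GB, nu π g ∈ nuIdeal π D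
  popped_le : ∀ d ∈ D, gval d ≤ gval f
  basis_le : ∀ g ∈ GB, gval g ≤ gval f
  le_queue : ∀ q ∈ Q, gval f ≤ gval q
  lift_syzygy : ∀ h ∈ nuIdeal π D, red h = 0 → ∃ z ∈ nuIdeal π D,
    h - unif π n * z ∈ Ideal.span (raisedSet π D (insert f D ∪ {q | q ∈ Q}))
  finite_pairs : G.Finite
  finite_jpairs : B.Finite
  bot_mem : ∀ g ∈ GB, ((⊥ : Sig n), g) ∈ G
  one_mem : (((0 : TMon n) : Sig n), f) ∈ G
  of_mem_pairs : ∀ p ∈ G, (p.1 = ⊥ ∧ p.2 ∈ GB) ∨ ∃ i, HasSig ord π (nuIdeal π D) f i p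
  of_mem_jpairs : ∀ p ∈ B, f ≠ 0 ∧ (∃ i, HasSig ord π (nuIdeal π D) f i p) ∧
    ∃ w, RegStep ord G p.1 p.2 w
  syzygy : ∀ i, ((0, i) : TMon n) ∈ S → ∃ b, red b ≠ 0 ∧ ord.degree (red b) = i ∧
    b * nu π f ∈ nuIdeal π D ⊔ Ideal.span (raisedSet π (insert f D) (insert f D ∪ {q | q ∈ Q}))
  jpair : ∀ p₁ ∈ G, ∀ p₂ ∈ G, ∀ p, IsJPair ord π p₁ p₂ p →
    p ∈ B ∨ IsCovered ord G p ∨ IsDivisible S p.1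

variable {D GB : Set (IntSeries v n)} {Q : Multiset (IntSeries v n)} {S : Set (TMon n)}
  {B : Set (SPair v n)}

theorem InnerInv.pairs (h : InnerInv ord π D GB Q f G S B) :
    ∀ p ∈ G, (p.1 = ⊥ ∧ nu π p.2 ∈ nuIdeal π D ∧ gval p.2 ≤ gval f) ∨
      ∃ i, HasSig ord π (nuIdeal π D) f i p :=
  fun p hp => (h.of_mem_pairs p hp).imp_left fun ⟨h1, h2⟩ => ⟨h1, h.nu_mem _ h2, h.basis_le _ h2⟩

theorem OuterInv.pop (h : OuterInv ord π D (f ::ₘ Q) GB) (hmin : ∀ g ∈ Q, gval f ≤ gval g) :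
    InnerInv ord π D GB Q f
      ({p | ∃ g ∈ GB, p = (⊥, g)} ∪ {(((0 : TMon n) : Sig n), f)})
      {s | ∃ g ∈ GB, LM ord g = s}
      {p | ∃ g ∈ GB, IsJPair ord π (((0 : TMon n) : Sig n), f) (⊥, g) p} := by
  have hone : HasSig ord π (nuIdeal π D) f 0 (((0 : TMon n) : Sig n), f) :=
    ⟨rfl, rfl, nu π f, 1, unif_pow_mul_nu π f, by simp, by simp, by simp⟩
  have hG : ∀ p ∈ ({p | ∃ g ∈ GB, p = (⊥, g)} ∪ {(((0 : TMon n) : Sig n), f)} : Set (SPair v n)),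
      (p.1 = ⊥ ∧ p.2 ∈ GB) ∨ ∃ i, HasSig ord π (nuIdeal π D) f i p := by
    rintro p (⟨g, hg, rfl⟩ | rfl)
    · exact Or.inl ⟨rfl, hg⟩
    · exact Or.inr ⟨0, hone⟩
  have hbasis : ∀ g ∈ GB, gval g ≤ gval f := fun g hg =>
    h.basis_le g hg f (Multiset.mem_cons_self _ _)
  have hG' : ∀ p ∈ ({p | ∃ g ∈ GB, p = (⊥, g)} ∪ {(((0 : TMon n) : Sig n), f)} : Set (SPair v n)),
      (p.1 = ⊥ ∧ nu π p.2 ∈ nuIdeal π D ∧ gval p.2 ≤ gval f) ∨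
      ∃ i, HasSig ord π (nuIdeal π D) f i p :=
    fun p hp => (hG p hp).imp_left fun ⟨h1, h2⟩ => ⟨h1, h.nu_mem _ h2, hbasis _ h2⟩
  have hmem : ∀ g ∈ GB, ((⊥ : Sig n), g) ∈
      ({p | ∃ g ∈ GB, p = (⊥, g)} ∪ {(((0 : TMon n) : Sig n), f)} : Set (SPair v n)) :=
    fun g hg => Or.inl ⟨g, hg, rfl⟩
  have hW : D ∪ {q | q ∈ f ::ₘ Q} ⊆ insert f D ∪ {q | q ∈ Q} := by
    rintro w (hw | hw)
    · exact Or.inl (Or.inr hw)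
    · rcases Multiset.mem_cons.1 hw with rfl | hw
      · exact Or.inl (Or.inl rfl)
      · exact Or.inr hw
  have hGfin : ({p | ∃ g ∈ GB, p = (⊥, g)} : Set (SPair v n)).Finite :=
    (h.finite_basis.image fun g => ((⊥ : Sig n), g)).subset
      fun p ⟨g, hg, hp⟩ => ⟨g, hg, hp.symm⟩
  refine ⟨h.finite_basis, h.groebner, h.nu_mem,
    fun d hd => h.popped_le d hd f (Multiset.mem_cons_self _ _), hbasis, hmin, ?_,
    hGfin.union (Set.finite_singleton _), ?_, hmem, Or.inr rfl, hG, ?_, ?_, ?_⟩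
  · intro x hx hx0
    obtain ⟨z, hz, hxz⟩ := h.lift_syzygy x hx hx0
    exact ⟨z, hz, Ideal.span_mono (raisedSet_mono π subset_rfl hW) hxz⟩
  · refine (h.finite_basis.biUnion fun g _ => finite_setOf_isJPair ord π
      (((0 : TMon n) : Sig n), f) (⊥, g)).subset fun p ⟨g, hg, hp⟩ => ?_
    exact Set.mem_biUnion hg hp
  · rintro p ⟨g, hg, hp⟩
    obtain ⟨h1, h2⟩ := hp.hasSig hG' (Or.inr rfl) (hmem g hg)
    exact ⟨h1, h2, hp.exists_regStep (Or.inr rfl) (hmem g hg)⟩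
  · rintro i ⟨g, hg, hgi⟩
    obtain ⟨hg0, hgi⟩ := (LM_eq_coe_iff π).1 hgi
    refine ⟨nu π g, rho_ne_zero π hg0, (congrArg Prod.snd hgi).symm, Ideal.mem_sup_left ?_⟩
    exact Ideal.mul_mem_right _ _ (h.nu_mem g hg)
  · rintro p₁ (⟨g₁, hg₁, rfl⟩ | rfl) p₂ (⟨g₂, hg₂, rfl⟩ | rfl) p hp
    · obtain ⟨s₁, s₂, t₁, t₂, -, -, -, -, h5⟩ := hp
      simp only [WithBot.add_bot] at h5
      rcases h5 with h5 | h5 <;> exact absurd h5.1 (sigLT_irrefl _)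
    · exact Or.inl ⟨g₁, hg₁, hp.symm⟩
    · exact Or.inl ⟨g₂, hg₂, hp⟩
    · exact absurd hp not_isJPair_self

theorem InnerInv.discard (h : InnerInv ord π D GB Q f G S B) {p : SPair v n}
    (hp : IsCovered ord G p ∨ IsDivisible S p.1) :
    InnerInv ord π D GB Q f G S (B \ {p}) :=
  { h with
    finite_jpairs := h.finite_jpairs.subset Set.sdiff_subset
    of_mem_jpairs := fun q hq => h.of_mem_jpairs q hq.1
    jpair := fun p₁ h₁ p₂ h₂ q hq => by
      by_cases hqp : q = p
      · subst hqp; exact Or.inr hp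
      · exact (h.jpair p₁ h₁ p₂ h₂ q hq).imp_left fun hB => ⟨hB, hqp⟩ }

theorem InnerInv.raise (h : InnerInv ord π D GB Q f G S B) {p : SPair v n} {v₀ : IntSeries v n}
    (hp : p ∈ B) (hred : RegularReduce ord G p.1 p.2 v₀) (hval : gval f < gval v₀) :
    InnerInv ord π D GB (v₀ ::ₘ Q) f G (S ∪ {s | p.1 = s}) (B \ {p}) := by
  have hQ : insert f D ∪ {q | q ∈ Q} ⊆ insert f D ∪ {q | q ∈ v₀ ::ₘ Q} :=
    Set.union_subset_union_right _ fun q hq => Multiset.mem_cons_of_mem hq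
  obtain ⟨-, ⟨i, hpi, -, hlift⟩, -⟩ := h.of_mem_jpairs p hp
  exact { h with
    le_queue := fun q hq => by
      rcases Multiset.mem_cons.1 hq with rfl | hq
      · exact hval.le
      · exact h.le_queue q hq
    lift_syzygy := fun x hx hx0 => by
      obtain ⟨z, hz, hxz⟩ := h.lift_syzygy x hx hx0
      exact ⟨z, hz, Ideal.span_mono (raisedSet_mono π subset_rfl hQ) hxz⟩
    finite_jpairs := h.finite_jpairs.subset Set.sdiff_subset
    of_mem_jpairs := fun q hq => h.of_mem_jpairs q hq.1
    syzygy := by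
      rintro j (hj | hj)
      · obtain ⟨b, h1, h2, h3⟩ := h.syzygy j hj
        exact ⟨b, h1, h2, sup_le_sup_left (Ideal.span_mono (raisedSet_mono π subset_rfl hQ)) _ h3⟩
      · have hij : i = j := congrArg Prod.snd (WithBot.coe_injective (hpi.symm.trans hj))
        subst hij
        rw [hpi] at hred
        obtain ⟨y, b, hy, hyb, hb0, hbi⟩ := hlift.reflTransGen h.pairs hred.1
        refine ⟨b, hb0, hbi, ?_⟩
        have hyE : y ∈ raisedSet π (insert f D) (insert f D ∪ {q | q ∈ v₀ ::ₘ Q}) :=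
          ⟨f, Set.mem_insert _ _, v₀, Or.inr (Multiset.mem_cons_self _ _), hval, hy⟩
        have := Ideal.sub_mem _ (Ideal.mem_sup_right (Ideal.subset_span hyE))
          (Ideal.mem_sup_left hyb)
        rwa [sub_sub_cancel] at this
    jpair := fun p₁ h₁ p₂ h₂ q hq => by
      by_cases hqp : q = p
      · subst hqp
        exact Or.inr (Or.inr ⟨(0, i), Or.inr hpi, 0, by rw [hpi, zero_add]⟩)
      · exact (h.jpair p₁ h₁ p₂ h₂ q hq).imp (fun hB => ⟨hB, hqp⟩)
          (Or.imp_right (IsDivisible.mono Set.subset_union_left)) }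

theorem InnerInv.hasSig_keep (h : InnerInv ord π D GB Q f G S B) {p : SPair v n}
    {v₀ : IntSeries v n} (hp : p ∈ B) (hred : RegularReduce ord G p.1 p.2 v₀)
    (hval : ¬ gval f < gval v₀) {i : Fin n →₀ ℕ}
    (hi : HasSig ord π (nuIdeal π D) f i p) : HasSig ord π (nuIdeal π D) f i (p.1, v₀) := by
  obtain ⟨hf0, -, -⟩ := h.of_mem_jpairs p hp
  obtain ⟨hpi, -, hlift⟩ := hi
  rw [hpi] at hred
  have hl := hlift.reflTransGen h.pairs hred.1
  exact ⟨hpi, le_antisymm (not_lt.1 hval) (hl.le_gval hf0), hl⟩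

theorem InnerInv.keep (h : InnerInv ord π D GB Q f G S B) {p : SPair v n} {v₀ : IntSeries v n}
    (hp : p ∈ B) (hred : RegularReduce ord G p.1 p.2 v₀) (hval : ¬ gval f < gval v₀) :
    InnerInv ord π D GB Q f (G ∪ {(p.1, v₀)}) S
      ((B \ {p}) ∪ {q | ∃ r ∈ G, IsJPair ord π (p.1, v₀) r q}) := by
  obtain ⟨hf0, ⟨i, hi⟩, hstep⟩ := h.of_mem_jpairs p hp
  have hnew := h.hasSig_keep hp hred hval hi
  have hpairs : ∀ q ∈ G ∪ {(p.1, v₀)}, (q.1 = ⊥ ∧ q.2 ∈ GB) ∨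
      ∃ i, HasSig ord π (nuIdeal π D) f i q := by
    rintro q (hq | rfl)
    · exact h.of_mem_pairs q hq
    · exact Or.inr ⟨i, hnew⟩
  have hpairs' : ∀ q ∈ G ∪ {(p.1, v₀)}, (q.1 = ⊥ ∧ nu π q.2 ∈ nuIdeal π D ∧ gval q.2 ≤ gval f) ∨
      ∃ i, HasSig ord π (nuIdeal π D) f i q :=
    fun q hq => (hpairs q hq).imp_left fun ⟨h1, h2⟩ => ⟨h1, h.nu_mem _ h2, h.basis_le _ h2⟩
  exact { h with
    finite_pairs := h.finite_pairs.union (Set.finite_singleton _)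
    finite_jpairs := by
      refine (h.finite_jpairs.subset Set.sdiff_subset).union ?_
      refine (h.finite_pairs.biUnion fun r _ => finite_setOf_isJPair ord π (p.1, v₀) r).subset
        fun q ⟨r, hr, hq⟩ => ?_
      exact Set.mem_biUnion hr hq
    bot_mem := fun g hg => Or.inl (h.bot_mem g hg)
    one_mem := Or.inl h.one_mem
    of_mem_pairs := hpairs
    of_mem_jpairs := by
      rintro q (hq | ⟨r, hr, hq⟩)
      · obtain ⟨h1, h2, w, hw⟩ := h.of_mem_jpairs q hq.1
        exact ⟨h1, h2, w, hw.mono Set.subset_union_left⟩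
      · obtain ⟨h1, h2⟩ := hq.hasSig hpairs' (Or.inr rfl) (Or.inl hr)
        exact ⟨h1, h2, hq.exists_regStep (Or.inr rfl) (Or.inl hr)⟩
    jpair := by
      rintro p₁ (h₁ | rfl) p₂ (h₂ | rfl) q hq
      · by_cases hqp : q = p
        · -- the pair `p` is covered by its own reduction
          subst hqp
          refine Or.inr (Or.inl ⟨(q.1, v₀), Or.inr rfl, (0, i), 0, hi.1, ?_, ?_⟩)
          · rw [hi.1, zero_add]
          · rw [WithBot.coe_zero, zero_add]
            exact hred.LM_lt π hstep
        · exact (h.jpair p₁ h₁ p₂ h₂ q hq).imp (fun hB => Or.inl ⟨hB, hqp⟩)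
            (Or.imp_left (IsCovered.mono Set.subset_union_left))
      · exact Or.inl (Or.inr ⟨p₁, h₁, hq.symm⟩)
      · exact Or.inl (Or.inr ⟨p₂, h₂, hq⟩)
      · exact absurd hq not_isJPair_self }

end Invariants

/-! ### The end of the inner loop -/

section Finish

variable {K : Type*} [Field K] {v : AddValuation K (WithTop ℤ)} {n : ℕ}
  {ord : MonomialOrder (Fin n)} {π : Uniformizer v} {f : IntSeries v n} {G : Set (SPair v n)}
  {D GB : Set (IntSeries v n)} {Q : Multiset (IntSeries v n)} {S : Set (TMon n)}
  {B : Set (SPair v n)} {H : Ideal (IntSeries v n)}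

theorem HasSig.ne_zero {i : Fin n →₀ ℕ} {p : SPair v n} (hf : f ≠ 0)
    (h : HasSig ord π H f i p) : p.2 ≠ 0 ∧ nval p.2 = nval f := by
  have h1 := h.2.1
  rw [gval_eq_nval hf] at h1
  exact nval_eq_of_gval_eq h1

theorem HasSig.LM_eq {i : Fin n →₀ ℕ} {p : SPair v n} (hf : f ≠ 0)
    (h : HasSig ord π H f i p) : LM ord p.2 = ((nval f, ord.degree (rho π p.2)) : TMon n) := by
  obtain ⟨h1, h2⟩ := h.ne_zero hf
  rw [Tate.LM_eq π h1, h2]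

theorem HasSig.exists_nu_sub_mem {i : Fin n →₀ ℕ} {p : SPair v n} (hf : f ≠ 0)
    (h : HasSig ord π H f i p) :
    ∃ b, nu π p.2 - b * nu π f ∈ H ∧ red b ≠ 0 ∧ ord.degree (red b) = i := by
  obtain ⟨y, b, hy, h1⟩ := h.2.2
  rw [← (h.ne_zero hf).2] at hy
  rw [eq_nu_of_nval_eq π hy] at h1
  exact ⟨b, h1⟩

/-- The reductions of the pairs in the inner loop satisfy the hypotheses of the cover criterion
when no J-pair is left. -/
theorem InnerInv.isCoveredBasis (h : InnerInv ord π D GB Q f G S ∅) (hf : f ≠ 0) :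
    IsCoveredBasis ord (Ideal.span (rho π '' D)) (rho π f) (rho π '' GB)
      {x | ∃ p ∈ G, p.1 = ((0, x.1) : TMon n) ∧ rho π p.2 = x.2} {i | ((0, i) : TMon n) ∈ S} := by
  have hsig : ∀ p ∈ G, ∀ a i, p.1 = ((a, i) : TMon n) →
      a = 0 ∧ HasSig ord π (nuIdeal π D) f i p := by
    intro p hp a i hpi
    rcases h.of_mem_pairs p hp with ⟨h1, _⟩ | ⟨j, hj⟩
    · rw [h1] at hpi; exact absurd hpi WithBot.bot_ne_coe
    · obtain ⟨rfl, rfl⟩ := Prod.mk.inj (WithBot.coe_injective (hj.1.symm.trans hpi))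
      exact ⟨rfl, hj⟩
  -- the J-pairs over the residue field come from J-pairs of series
  have key : ∀ p ∈ G, ∀ i, HasSig ord π (nuIdeal π D) f i p → ∀ q ∈ G, q.2 ≠ 0 →
      nval q.2 ≤ nval f → ∀ t t' : Fin n →₀ ℕ,
      t + ord.degree (rho π p.2) = ord.degree (rho π p.2) ⊔ ord.degree (rho π q.2) →
      t' + ord.degree (rho π q.2) = ord.degree (rho π p.2) ⊔ ord.degree (rho π q.2) →
      sigLT ord (((nval f - nval q.2, t') : TMon n) + q.1) ((0, t + i) : TMon n) →
      CoveredOrDivisible ord {x | ∃ p ∈ G, p.1 = ((0, x.1) : TMon n) ∧ rho π p.2 = x.2}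
        {i | ((0, i) : TMon n) ∈ S} t i (rho π p.2) := by
    intro p hp i hpi q hq hq0 hle t t' ht ht' hlt
    have hlt' : sigLT ord (((nval f - nval q.2, t') : TMon n) + q.1)
        (((0, t) : TMon n) + p.1) := by
      rw [hpi.1, ← WithBot.coe_add]; exact hlt
    have hJ : IsJPair ord π p q (mulPair π (0, t) p) := by
      refine ⟨_, _, (0, t), (nval f - nval q.2, t'), hpi.LM_eq hf, LM_eq π hq0, ?_, ?_,
        Or.inr ⟨hlt', rfl⟩⟩
      · rw [Prod.mk_add_mk, Prod.mk_sup_mk, ht, sup_eq_left.2 hle, zero_add]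
      · rw [Prod.mk_add_mk, Prod.mk_sup_mk, ht', sup_eq_left.2 hle, Nat.sub_add_cancel hle]
    have hfst : (mulPair π (0, t) p).1 = ((0, t + i) : TMon n) := by
      rw [mulPair, hpi.1, ← WithBot.coe_add]; rfl
    rcases h.jpair p hp q hq _ hJ with h1 | ⟨r, hr, ⟨a, j⟩, ⟨b, t₃⟩, h1, h2, h3⟩ |
      ⟨⟨a, s⟩, hs, ⟨b, t₃⟩, h1⟩
    · exact absurd h1 (Set.notMem_empty _)
    · obtain ⟨rfl, hrj⟩ := hsig r hr a j h1
      rw [hfst] at h2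
      obtain ⟨h4, h5⟩ := Prod.mk.inj (WithBot.coe_injective h2)
      dsimp only at h4 h5
      obtain rfl : b = 0 := by omega
      rw [hrj.LM_eq hf, LM_mulPair_snd, hpi.LM_eq hf, ← WithBot.coe_add, ← WithBot.coe_add,
        sigLT_coe_iff] at h3
      refine Or.inl ⟨j, rho π r.2, t₃, ⟨r, hr, h1, rfl⟩, h5.symm, ?_⟩
      rcases h3 with h3 | h3
      · exact absurd h3 (lt_irrefl _)
      · exact h3.2
    · rw [hfst] at h1
      obtain ⟨h4, h5⟩ := Prod.mk.inj (WithBot.coe_injective h1)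
      dsimp only at h4 h5
      obtain rfl : a = 0 := by omega
      exact Or.inr ⟨s, hs, h5 ▸ le_add_self⟩
  refine ⟨h.groebner.2.2, ?_, ?_, ⟨_, h.one_mem, rfl, rfl⟩, ?_, ?_, ?_⟩
  · rintro i _ ⟨p, hp, hpi, rfl⟩
    exact rho_ne_zero π ((hsig p hp 0 i hpi).2.ne_zero hf).1
  · rintro i _ ⟨p, hp, hpi, rfl⟩
    obtain ⟨b, h1, h2, h3⟩ := (hsig p hp 0 i hpi).2.exists_nu_sub_mem hf
    refine ⟨red b, h2, h3, ?_⟩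
    have := red_mem_of_mem_nuIdeal π h1
    rwa [map_sub, map_mul] at this
  · intro i hi
    obtain ⟨b, h1, h2, h3⟩ := h.syzygy i hi
    refine ⟨red b, h1, h2, ?_⟩
    obtain ⟨x, hx, y, hy, hxy⟩ := Submodule.mem_sup.1 h3
    have := congrArg red hxy
    rw [map_add, red_eq_zero_of_mem_span_raisedSet π hy, add_zero, map_mul] at this
    change red b * red (nu π f) ∈ _
    rw [← this]
    exact red_mem_of_mem_nuIdeal π hx
  · rintro i _ ⟨p, hp, hpi, rfl⟩ _ ⟨g, hg, rfl⟩ hg0 t ht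
    have hg0' : g ≠ 0 := by rintro rfl; exact hg0 (rho_zero π)
    have hle : nval g ≤ nval f := by
      have := h.basis_le g hg
      rw [gval_eq_nval hf, gval_eq_nval hg0'] at this
      exact_mod_cast this
    obtain ⟨t', ht'⟩ := exists_add_of_le
      (le_sup_right : ord.degree (rho π g) ≤ ord.degree (rho π p.2) ⊔ ord.degree (rho π g))
    rw [add_comm] at ht'
    refine key p hp i (hsig p hp 0 i hpi).2 (⊥, g) (h.bot_mem g hg) hg0' hle t t' ht ht'.symm ?_
    rw [WithBot.add_bot]
    exact bot_sigLT_coe _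
  · rintro i _ ⟨p, hp, hpi, rfl⟩ j _ ⟨q, hq, hqj, rfl⟩ t t' ht ht' hlt
    have hq1 := (hsig q hq 0 j hqj).2
    obtain ⟨hq0, hqf⟩ := hq1.ne_zero hf
    refine key p hp i (hsig p hp 0 i hpi).2 q hq hq0 hqf.le t t' ht ht' ?_
    rw [hqj, ← WithBot.coe_add, sigLT_coe_iff, hqf]
    exact Or.inr ⟨by simp, hlt⟩

/-- The syzygies of `ρ(D ∪ {f})` lift: the leading monomial of the coefficient of `ρ(f)` is
divisible by an element of `S`, the lift of which lowers this coefficient. -/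
theorem InnerInv.exists_lift_syzygy (h : InnerInv ord π D GB Q f G S ∅) (hf : f ≠ 0)
    (x : IntSeries v n) (hx : x ∈ nuIdeal π (insert f D)) (hx0 : red x = 0) :
    ∃ z ∈ nuIdeal π (insert f D), x - unif π n * z ∈
      Ideal.span (raisedSet π (insert f D) (insert f D ∪ {q | q ∈ Q})) := by
  have hD : nuIdeal π D ≤ nuIdeal π (insert f D) := nuIdeal_mono π (Set.subset_insert _ _)
  have hfmem : nu π f ∈ nuIdeal π (insert f D) :=
    Ideal.subset_span ⟨f, Set.mem_insert _ _, rfl⟩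
  have hC := h.isCoveredBasis hf
  have base : ∀ a, ∀ y ∈ nuIdeal π D, red (a * nu π f + y) = 0 → red a = 0 →
      ∃ z ∈ nuIdeal π (insert f D), a * nu π f + y - unif π n * z ∈
        Ideal.span (raisedSet π (insert f D) (insert f D ∪ {q | q ∈ Q})) := by
    intro a y hy hred ha
    rw [map_add, map_mul, ha, zero_mul, zero_add] at hred
    obtain ⟨z, hz, hyz⟩ := h.lift_syzygy y hy hred
    obtain ⟨a', rfl⟩ := (red_eq_zero_iff π).1 ha
    refine ⟨a' * nu π f + z, Ideal.add_mem _ (Ideal.mul_mem_left _ _ hfmem) (hD hz), ?_⟩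
    have := Ideal.span_mono (raisedSet_mono π (Set.subset_insert f D) subset_rfl) hyz
    convert this using 1
    ring
  have main : ∀ d : ord.syn, ∀ a, ord.toSyn (ord.degree (red a)) = d → ∀ y ∈ nuIdeal π D,
      red (a * nu π f + y) = 0 → ∃ z ∈ nuIdeal π (insert f D), a * nu π f + y - unif π n * z ∈
        Ideal.span (raisedSet π (insert f D) (insert f D ∪ {q | q ∈ Q})) := by
    intro d
    induction d using WellFoundedLT.induction with
    | ind d ih =>
    rintro a rfl y hy hred
    by_cases ha : red a = 0
    · exact base a y hy hred ha
    have haJ : red a * rho π f ∈ Ideal.span (rho π '' D) := by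
      rw [map_add, map_mul] at hred
      change red a * red (nu π f) ∈ _
      rw [eq_neg_of_add_eq_zero_left hred]
      exact Ideal.neg_mem_iff _ |>.2 (red_mem_of_mem_nuIdeal π hy)
    obtain ⟨s, hs, hsa⟩ := hC.exists_le_degree_of_mul_mem ha haJ
    obtain ⟨b, hb0, rfl, hb⟩ := h.syzygy s hs
    obtain ⟨x', hx', e', he', hxe⟩ := Submodule.mem_sup.1 hb
    obtain ⟨t, ht⟩ := exists_add_of_le hsa
    rw [add_comm] at ht
    obtain ⟨c, hc⟩ := IsLocalRing.residue_surjective (R := valRing v)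
      (ord.leadingCoeff (red a) / ord.leadingCoeff (red b))
    have hlc : ord.leadingCoeff (red a) =
        IsLocalRing.residue (valRing v) c * ord.leadingCoeff (red b) := by
      rw [hc, div_mul_cancel₀ _ (ord.leadingCoeff_ne_zero_iff.2 hb0)]
    have hsum : (a - term c t * b) * nu π f + (y + term c t * x') =
        a * nu π f + y - term c t * e' := by
      linear_combination (term c t) * hxe
    have hred' : red ((a - term c t * b) * nu π f + (y + term c t * x')) = 0 := by
      rw [hsum, map_sub, hred, map_mul, red_eq_zero_of_mem_span_raisedSet π he', mul_zero, sub_zero]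
    have hy' : y + term c t * x' ∈ nuIdeal π D :=
      Ideal.add_mem _ hy (Ideal.mul_mem_left _ _ hx')
    have hra : red (a - term c t * b) = red a -
        MvPolynomial.monomial t (IsLocalRing.residue (valRing v) c) * red b := by
      rw [map_sub, map_mul, red_term]
    obtain ⟨z, hz, hxz⟩ : ∃ z ∈ nuIdeal π (insert f D),
        (a - term c t * b) * nu π f + (y + term c t * x') - unif π n * z ∈
        Ideal.span (raisedSet π (insert f D) (insert f D ∪ {q | q ∈ Q})) := by
      rcases sub_monomial_mul_eq_zero_or_degree_lt ht hlc with h1 | h1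
      · exact base _ _ hy' hred' (hra.trans h1)
      · exact ih _ (by rw [hra]; exact h1) _ rfl _ hy' hred'
    refine ⟨z, hz, ?_⟩
    have := Ideal.add_mem _ hxz (Ideal.mul_mem_left _ (term c t) he')
    convert this using 1
    rw [hsum]
    ring
  rw [nuIdeal, Set.image_insert_eq, Ideal.mem_span_insert] at hx
  obtain ⟨a, y, hy, rfl⟩ := hx
  exact main _ a rfl y hy hx0

theorem InnerInv.finish (h : InnerInv ord π D GB Q f G S ∅) :
    OuterInv ord π (insert f D) Q {g | ∃ u, (u, g) ∈ G} := by
  have hD : nuIdeal π D ≤ nuIdeal π (insert f D) := nuIdeal_mono π (Set.subset_insert _ _)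
  have hfmem : nu π f ∈ nuIdeal π (insert f D) :=
    Ideal.subset_span ⟨f, Set.mem_insert _ _, rfl⟩
  have hfin : {g | ∃ u, (u, g) ∈ G}.Finite :=
    (h.finite_pairs.image Prod.snd).subset fun g ⟨u, hu⟩ => ⟨(u, g), hu, rfl⟩
  have hnu : ∀ g ∈ {g | ∃ u, (u, g) ∈ G}, nu π g ∈ nuIdeal π (insert f D) := by
    rintro g ⟨u, hu⟩
    rcases h.of_mem_pairs _ hu with ⟨_, hg⟩ | ⟨i, hi⟩
    · exact hD (h.nu_mem g hg)
    · by_cases hf : f = 0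
      · have : g = 0 := by
          have h1 := hi.2.1
          rw [gval_eq_top_iff.2 hf, gval_eq_top_iff] at h1
          exact h1
        rw [this, nu_zero]
        exact Ideal.zero_mem _
      · obtain ⟨b, hb, _⟩ := hi.exists_nu_sub_mem hf
        have := Ideal.add_mem _ (hD hb) (Ideal.mul_mem_left _ b hfmem)
        rwa [sub_add_cancel] at this
  have hGB : ∀ g ∈ GB, g ∈ {g | ∃ u, (u, g) ∈ G} := fun g hg => ⟨⊥, h.bot_mem g hg⟩
  have hle : ∀ g ∈ {g | ∃ u, (u, g) ∈ G}, gval g ≤ gval f := by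
    rintro g ⟨u, hu⟩
    rcases h.of_mem_pairs _ hu with ⟨_, hg⟩ | ⟨i, hi⟩
    · exact h.basis_le g hg
    · exact hi.2.1.le
  refine ⟨hfin, ⟨hfin.image _, ?_, ?_⟩, hnu, ?_,
    fun g hg q hq => (hle g hg).trans (h.le_queue q hq), ?_⟩
  · rintro _ ⟨g, hg, rfl⟩
    exact red_mem_of_mem_nuIdeal π (hnu g hg)
  · intro p hp hp0
    rw [Set.image_insert_eq, Ideal.span_insert] at hp
    by_cases hf : f = 0
    · rw [hf, rho_zero, Ideal.span_singleton_zero, bot_sup_eq] at hp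
      obtain ⟨_, ⟨g, hg, rfl⟩, h1⟩ := h.groebner.2.2 p hp hp0
      exact ⟨_, ⟨g, hGB g hg, rfl⟩, h1⟩
    · rw [sup_comm] at hp
      have hC := h.isCoveredBasis hf
      rcases hC.exists_degree_le_of_mem_sup hp hp0 with ⟨_, ⟨g, hg, rfl⟩, h1⟩ |
        ⟨i, g, hg, h1⟩
      · exact ⟨_, ⟨g, hGB g hg, rfl⟩, h1⟩
      · have hg0 := hC.ne_zero i g hg
        obtain ⟨p, hp, _, rfl⟩ := hg
        exact ⟨_, ⟨p.2, ⟨p.1, hp⟩, rfl⟩, hg0, h1⟩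
  · rintro d (rfl | hd) q hq
    · exact h.le_queue q hq
    · exact (h.popped_le d hd).trans (h.le_queue q hq)
  · by_cases hf : f = 0
    · intro x hx hx0
      rw [nuIdeal, Set.image_insert_eq, hf, nu_zero, Ideal.span_insert, Ideal.span_singleton_zero,
        bot_sup_eq] at hx
      obtain ⟨z, hz, hxz⟩ := h.lift_syzygy x hx hx0
      exact ⟨z, hD hz,
        Ideal.span_mono (raisedSet_mono π (Set.subset_insert f D) subset_rfl) hxz⟩
    · exact h.exists_lift_syzygy hf

/-- The signature and leading monomial of a pair added to `G` are not both divisible by those of a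
pair already in `G`: the J-pair would have been covered, or could be reduced further. -/
theorem InnerInv.not_le_of_keep (h : InnerInv ord π D GB Q f G S B) {p : SPair v n}
    {v₀ : IntSeries v n} (hp : p ∈ B) (hcov : ¬ IsCovered ord G p)
    (hred : RegularReduce ord G p.1 p.2 v₀) (hval : ¬ gval f < gval v₀) {i j : Fin n →₀ ℕ}
    (hi : p.1 = ((0, i) : TMon n)) {q : SPair v n} (hq : q ∈ G) (hj : q.1 = ((0, j) : TMon n))
    (hij : j ≤ i) : ¬ ord.degree (rho π q.2) ≤ ord.degree (rho π v₀) := by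
  intro hle
  obtain ⟨hf, ⟨i', hpi⟩, hstep⟩ := h.of_mem_jpairs p hp
  obtain rfl : i' = i := congrArg Prod.snd (WithBot.coe_injective (hpi.1.symm.trans hi))
  have hnew := h.hasSig_keep hp hred hval hpi
  have hqj : HasSig ord π (nuIdeal π D) f j q := by
    rcases h.of_mem_pairs q hq with ⟨h1, _⟩ | ⟨j', hj'⟩
    · rw [h1] at hj; exact absurd hj WithBot.bot_ne_coe
    · obtain rfl : j' = j := congrArg Prod.snd (WithBot.coe_injective (hj'.1.symm.trans hj))
      exact hj'
  obtain ⟨e, rfl⟩ := exists_add_of_le hij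
  obtain ⟨e', he'⟩ := exists_add_of_le hle
  have hLMv : LM ord v₀ = (((0, e') : TMon n) + (nval f, ord.degree (rho π q.2)) : TMon n) := by
    rw [hnew.LM_eq hf, he', add_comm, Prod.mk_add_mk, zero_add]
  have hlt := hred.LM_lt π hstep
  rcases lt_or_ge (ord.toSyn e') (ord.toSyn e) with hee | hee
  · -- a further regular top-reduction by `q` is possible
    obtain ⟨w, hw⟩ := exists_regStep π (u := p.1) hq (hqj.LM_eq hf) hLMv (by
      rw [hi, hj, ← WithBot.coe_add, sigLT_coe_iff]
      refine Or.inr ⟨rfl, ?_⟩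
      change ord.toSyn (e' + j) < ord.toSyn (j + e)
      rw [add_comm, map_add, map_add]
      gcongr)
    rcases hred.2 with h1 | h1
    · exact h1 w hw
    · rw [hpi.2.1] at h1
      exact hval h1
  · -- the pair `p` is covered by `q`
    refine hcov ⟨q, hq, (0, j), (0, e), hj, ?_, ?_⟩
    · rw [hi, Prod.mk_add_mk, add_comm]
    · rw [hqj.LM_eq hf, ← WithBot.coe_add]
      rcases hee.eq_or_lt with h1 | h1
      · rw [ord.toSyn.injective h1, ← hLMv]
        exact hlt
      · refine sigLT.trans ?_ hlt
        rw [hLMv, sigLT_coe_iff]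
        refine Or.inr ⟨rfl, ?_⟩
        change ord.toSyn (e + _) < ord.toSyn (e' + _)
        rw [map_add, map_add]
        gcongr

end Finish

/-! ### Invariants of a run -/

section Runs

variable {K : Type*} [Field K] {v : AddValuation K (WithTop ℤ)} {n : ℕ}
  {ord : MonomialOrder (Fin n)} {π : Uniformizer v}

/-- The value of the variable `Q` in a state. -/
def State.queue : State v n → Multiset (IntSeries v n)
  | .outer Q _ => Q
  | .inner Q _ _ _ _ => Q

/-- The series being processed by the inner loop (none at the head of the main loop). -/
def State.current : State v n → Set (IntSeries v n)
  | .outer _ _ => ∅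
  | .inner _ f _ _ _ => {f}

/-- The set of the series popped from `Q` up to time `t`. -/
def poppedUpTo (σ : ℕ → State v n) (t : ℕ) : Set (IntSeries v n) :=
  {f | ∃ s ≤ t, f ∈ (σ s).current}

theorem poppedUpTo_succ (σ : ℕ → State v n) (t : ℕ) :
    poppedUpTo σ (t + 1) = poppedUpTo σ t ∪ (σ (t + 1)).current := by
  ext f
  constructor
  · rintro ⟨s, hs, hf⟩
    rcases Nat.le_succ_iff.1 hs with hs | rfl
    · exact Or.inl ⟨s, hs, hf⟩
    · exact Or.inr hf
  · rintro (⟨s, hs, hf⟩ | hf)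
    · exact ⟨s, hs.trans t.le_succ, hf⟩
    · exact ⟨t + 1, le_rfl, hf⟩

theorem mem_Qall_iff {σ : ℕ → State v n} {f : IntSeries v n} :
    f ∈ Qall σ ↔ ∃ t, f ∈ (σ t).current := by
  refine exists_congr fun t => ?_
  cases h : σ t with
  | outer Q GB => simp [State.current]
  | inner Q g G S B =>
    simp only [State.current, Set.mem_singleton_iff, State.inner.injEq]
    exact ⟨fun ⟨_, _, _, _, _, h, _⟩ => h.symm, fun h => ⟨Q, G, S, B, rfl, h.symm, rfl, rfl, rfl⟩⟩

theorem mem_Qall_of_mem_poppedUpTo {σ : ℕ → State v n} {t : ℕ} {f : IntSeries v n}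
    (hf : f ∈ poppedUpTo σ t) : f ∈ Qall σ :=
  let ⟨s, _, h⟩ := hf
  mem_Qall_iff.2 ⟨s, h⟩

theorem finite_poppedUpTo (σ : ℕ → State v n) (t : ℕ) : (poppedUpTo σ t).Finite := by
  have hfin : ∀ s : State v n, s.current.Finite := fun s => by
    cases s with
    | outer Q GB => exact Set.finite_empty
    | inner Q g G S B => exact Set.finite_singleton g
  refine ((Set.finite_Iic t).biUnion fun s _ => hfin (σ s)).subset fun f ⟨s, hs, hf⟩ => ?_
  exact Set.mem_biUnion hs hf

/-- The invariant of a state, where `D` is the set of the series popped so far. -/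
def StateInv (ord : MonomialOrder (Fin n)) (π : Uniformizer v) (D : Set (IntSeries v n)) :
    State v n → Prop
  | .outer Q GB => OuterInv ord π D Q GB
  | .inner Q f G S B => ∃ D₀ GB₀, D = insert f D₀ ∧ InnerInv ord π D₀ GB₀ Q f G S B

theorem StateInv.step {D : Set (IntSeries v n)} {s s' : State v n} (h : StateInv ord π D s)
    (hs : Step ord π s s') : StateInv ord π (D ∪ s'.current) s' := by
  cases hs with
  | pop Q GB f hmin => exact ⟨D, GB, Set.union_singleton, OuterInv.pop h hmin⟩
  | discard Q f G S B p hp hd =>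
    obtain ⟨D₀, GB₀, rfl, h⟩ := h
    exact ⟨D₀, GB₀, Set.union_eq_left.2 (by simp [State.current]), h.discard hd⟩
  | raise Q f G S B p v₀ hp hcov hdiv hred hval =>
    obtain ⟨D₀, GB₀, rfl, h⟩ := h
    exact ⟨D₀, GB₀, Set.union_eq_left.2 (by simp [State.current]), h.raise hp.1 hred hval⟩
  | keep Q f G S B p v₀ hp hcov hdiv hred hval =>
    obtain ⟨D₀, GB₀, rfl, h⟩ := h
    exact ⟨D₀, GB₀, Set.union_eq_left.2 (by simp [State.current]), h.keep hp.1 hred hval⟩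
  | finish Q f G S =>
    obtain ⟨D₀, GB₀, rfl, h⟩ := h
    change OuterInv ord π (_ ∪ ∅) _ _
    rw [Set.union_empty]
    exact h.finish

variable {m : ℕ} {f : Fin m → IntSeries v n} {σ : ℕ → State v n}

theorem poppedUpTo_zero (hσ : IsRun ord π f σ) : poppedUpTo σ 0 = ∅ := by
  ext g
  simp [poppedUpTo, hσ.1, State.current]

theorem stateInv (hσ : IsRun ord π f σ) (t : ℕ) : StateInv ord π (poppedUpTo σ t) (σ t) := by
  induction t with
  | zero =>
    rw [poppedUpTo_zero hσ, hσ.1]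
    refine ⟨Set.finite_empty, ⟨by simp, by simp, fun p hp h0 => ?_⟩, by simp, by simp, by simp,
      fun x hx _ => ⟨0, Ideal.zero_mem _, ?_⟩⟩
    · simp only [Set.image_empty, Ideal.span_empty] at hp
      exact absurd hp h0
    · simp only [nuIdeal, Set.image_empty, Ideal.span_empty] at hx
      rw [show x = 0 from hx, mul_zero, sub_zero]
      exact Ideal.zero_mem _
  | succ t ih =>
    rw [poppedUpTo_succ]
    rcases hσ.2 t with h | ⟨⟨GB, h⟩, h'⟩
    · exact ih.step h
    · rw [h', h, State.current, Set.union_empty]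
      rwa [h] at ih

/-- The elements of `Q` and the series popped so far form an increasing family. -/
theorem poppedUpTo_union_queue_mono (hσ : IsRun ord π f σ) :
    Monotone fun t => poppedUpTo σ t ∪ {q | q ∈ (σ t).queue} := by
  refine monotone_nat_of_le_succ fun t => ?_
  rw [poppedUpTo_succ]
  rintro w (hw | hw)
  · exact Or.inl (Or.inl hw)
  rcases hσ.2 t with h | ⟨⟨GB, h⟩, h'⟩
  · generalize σ t = s at h hw
    generalize σ (t + 1) = s' at h
    cases h with
    | pop Q GB f hmin =>
      rcases Multiset.mem_cons.1 hw with rfl | hw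
      · exact Or.inl (Or.inr rfl)
      · exact Or.inr hw
    | raise Q f G S B p v₀ hp hcov hdiv hred hval => exact Or.inr (Multiset.mem_cons_of_mem hw)
    | _ => exact Or.inr hw
  · rw [h']; exact Or.inr hw

/-- The series found when the valuation rises belong to any ideal containing the popped series. -/
theorem HasLift.mem_ideal {D : Set (IntSeries v n)} {g w : IntSeries v n}
    {I : Ideal (IntSeries v n)} {i : Fin n →₀ ℕ} (hg : g ≠ 0) (hD : D ⊆ I) (hgI : g ∈ I)
    (hle : ∀ d ∈ D, gval d ≤ gval g) (h : HasLift ord π (nuIdeal π D) g i w) : w ∈ I := by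
  obtain ⟨y, b, rfl, hyb, -⟩ := h
  have key : ∀ x ∈ nuIdeal π D, unif π n ^ nval g * x ∈ I := by
    intro x hx
    refine Submodule.span_induction ?_ ?_ ?_ ?_ hx
    · rintro _ ⟨d, hd, rfl⟩
      have h1 := hle d hd
      rw [gval_eq_nval hg] at h1
      have hd0 : d ≠ 0 := by
        rintro rfl
        rw [gval_eq_top_iff.2 rfl] at h1
        exact absurd h1 (by simp)
      rw [gval_eq_nval hd0] at h1
      have h1 : nval d ≤ nval g := by exact_mod_cast h1
      rw [← Nat.sub_add_cancel h1, pow_add, mul_assoc, unif_pow_mul_nu]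
      exact I.mul_mem_left _ (hD hd)
    · rw [mul_zero]; exact I.zero_mem
    · intro x y _ _ hx hy
      rw [mul_add]; exact I.add_mem hx hy
    · intro a x _ hx
      rw [smul_eq_mul, mul_left_comm]; exact I.mul_mem_left _ hx
  have h1 := I.add_mem (key _ hyb) (I.mul_mem_left b hgI)
  convert h1 using 1
  linear_combination b * unif_pow_mul_nu π g

theorem poppedUpTo_union_queue_subset (hσ : IsRun ord π f σ) (t : ℕ) :
    poppedUpTo σ t ∪ {q | q ∈ (σ t).queue} ⊆
      (Ideal.span (Set.range f) : Ideal (IntSeries v n)) := by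
  induction t with
  | zero =>
    rw [poppedUpTo_zero hσ, hσ.1, Set.empty_union]
    intro q hq
    obtain ⟨i, -, rfl⟩ := Multiset.mem_map.1 (show q ∈ Finset.univ.val.map f from hq)
    exact Ideal.subset_span ⟨i, rfl⟩
  | succ t ih =>
    have hinv := stateInv hσ t
    rw [poppedUpTo_succ]
    rcases hσ.2 t with h | ⟨⟨GB, h⟩, h'⟩
    · generalize poppedUpTo σ t = D at *
      generalize σ t = s at *
      generalize σ (t + 1) = s' at *
      cases h with
      | pop Q GB f hmin =>
        rintro w ((hw | rfl) | hw)
        · exact ih (Or.inl hw)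
        · exact ih (Or.inr (Multiset.mem_cons_self _ _))
        · exact ih (Or.inr (Multiset.mem_cons_of_mem hw))
      | raise Q g G S B p v₀ hp hcov hdiv hred hval =>
        obtain ⟨D₀, GB₀, rfl, hinv⟩ := hinv
        have hD : insert g D₀ ⊆ (Ideal.span (Set.range f) : Ideal (IntSeries v n)) :=
          fun d hd => ih (Or.inl hd)
        rintro w ((hw | rfl) | hw)
        · exact hD hw
        · exact hD (Set.mem_insert _ _)
        · rcases Multiset.mem_cons.1 hw with rfl | hw
          · obtain ⟨hg, ⟨i, hpi, -, hl⟩, -⟩ := hinv.of_mem_jpairs p hp.1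
            rw [hpi] at hred
            exact (hl.reflTransGen hinv.pairs hred.1).mem_ideal hg
              (fun d hd => hD (Set.mem_insert_of_mem _ hd)) (hD (Set.mem_insert _ _))
              hinv.popped_le
          · exact ih (Or.inr hw)
      | finish Q g G S =>
        rw [State.current, Set.union_empty]
        exact ih
      | _ =>
        obtain ⟨D₀, GB₀, rfl, hinv⟩ := hinv
        rintro w ((hw | rfl) | hw)
        · exact ih (Or.inl hw)
        · exact ih (Or.inl (Set.mem_insert _ _))
        · exact ih (Or.inr hw)
    · rw [h', h, State.current, Set.union_empty]
      rwa [h] at ih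

/-- Once all elements of `Q` have a valuation at least `c`, this remains true, also for the series
popped later. -/
theorem le_gval_of_le (hσ : IsRun ord π f σ) {c : WithTop ℤ} {t : ℕ}
    (ht : ∀ q ∈ (σ t).queue, c ≤ gval q) (ht' : ∀ g ∈ (σ t).current, c ≤ gval g) {s : ℕ}
    (hs : t ≤ s) : (∀ q ∈ (σ s).queue, c ≤ gval q) ∧ ∀ g ∈ (σ s).current, c ≤ gval g := by
  induction s, hs using Nat.le_induction with
  | base => exact ⟨ht, ht'⟩
  | succ s _ ih =>
    rcases hσ.2 s with h | ⟨-, h'⟩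
    · generalize σ s = s₁ at *
      generalize σ (s + 1) = s₂ at *
      cases h with
      | pop Q GB f hmin =>
        refine ⟨fun q hq => ih.1 q (Multiset.mem_cons_of_mem hq), ?_⟩
        rintro g rfl
        exact ih.1 g (Multiset.mem_cons_self _ _)
      | raise Q g G S B p v₀ hp hcov hdiv hred hval =>
        refine ⟨fun q hq => ?_, ih.2⟩
        rcases Multiset.mem_cons.1 hq with rfl | hq
        · exact (ih.2 g rfl).trans hval.le
        · exact ih.1 q hq
      | finish Q g G S => exact ⟨ih.1, fun g hg => absurd hg (Set.notMem_empty _)⟩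
      | _ => exact ih
    · rw [h']; exact ih

/-! ### Termination -/

/-- The progress made by an iteration of the inner loop. -/
theorem InnerInv.progress {D GB : Set (IntSeries v n)} {Q Q' : Multiset (IntSeries v n)}
    {g g' : IntSeries v n} {G G' B B' : Set (SPair v n)} {S S' : Set (TMon n)}
    (h : InnerInv ord π D GB Q g G S B)
    (hs : Step ord π (.inner Q g G S B) (.inner Q' g' G' S' B')) :
    G ⊆ G' ∧ (B'.ncard < B.ncard ∨ ∃ i w, ((((0, i) : TMon n) : Sig n), w) ∈ G' ∧
      ∀ j q, ((((0, j) : TMon n) : Sig n), q) ∈ G → j ≤ i →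
        ¬ ord.degree (rho π q) ≤ ord.degree (rho π w)) := by
  cases hs with
  | discard _ _ _ _ _ p hp hd =>
    exact ⟨subset_rfl, Or.inl (Set.ncard_sdiff_singleton_lt_of_mem hp.1 h.finite_jpairs)⟩
  | raise _ _ _ _ _ p v₀ hp hcov hdiv hred hval =>
    exact ⟨subset_rfl, Or.inl (Set.ncard_sdiff_singleton_lt_of_mem hp.1 h.finite_jpairs)⟩
  | keep _ _ _ _ _ p v₀ hp hcov hdiv hred hval =>
    obtain ⟨-, ⟨i, hi⟩, -⟩ := h.of_mem_jpairs p hp.1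
    refine ⟨Set.subset_union_left, Or.inr ⟨i, v₀, Or.inr (by rw [← hi.1]; rfl), ?_⟩⟩
    intro j q hq hij
    exact h.not_le_of_keep hp.1 hcov hred hval hi.1
      (q := ((((0, j) : TMon n) : Sig n), q)) hq rfl hij

/-- The inner loop terminates: by Dickson's lemma, only finitely many pairs are added to `G`. -/
theorem exists_outer (hσ : IsRun ord π f σ) (T : ℕ) : ∃ t ≥ T, ∃ Q GB, σ t = .outer Q GB := by
  by_contra! hcon
  have hin : ∀ k, ∃ Q g G S B, σ (T + k) = .inner Q g G S B := by
    intro k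
    cases h : σ (T + k) with
    | outer Q GB => exact absurd h (hcon _ (by omega) Q GB)
    | inner Q g G S B => exact ⟨Q, g, G, S, B, rfl⟩
  choose Q g G S B hst using hin
  have hinv : ∀ k, ∃ D GB, InnerInv ord π D GB (Q k) (g k) (G k) (S k) (B k) := by
    intro k
    have := stateInv hσ (T + k)
    rw [hst] at this
    obtain ⟨D, GB, -, h⟩ := this
    exact ⟨D, GB, h⟩
  have hprog : ∀ k, G k ⊆ G (k + 1) ∧ ((B (k + 1)).ncard < (B k).ncard ∨
      ∃ i w, ((((0, i) : TMon n) : Sig n), w) ∈ G (k + 1) ∧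
        ∀ j q, ((((0, j) : TMon n) : Sig n), q) ∈ G k → j ≤ i →
          ¬ ord.degree (rho π q) ≤ ord.degree (rho π w)) := fun k => by
    obtain ⟨D, GB, h⟩ := hinv k
    rcases hσ.2 (T + k) with h1 | ⟨⟨GB, h1⟩, -⟩
    · rw [hst, add_assoc, hst] at h1
      exact h.progress h1
    · rw [hst] at h1; cases h1
  have hG : Monotone G := monotone_nat_of_le_succ fun k => (hprog k).1
  by_cases hfin : ∃ k₀, ∀ k ≥ k₀, (B (k + 1)).ncard < (B k).ncard
  · obtain ⟨k₀, hk₀⟩ := hfin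
    have : ∀ l, (B (k₀ + l)).ncard + l ≤ (B k₀).ncard := by
      intro l
      induction l with
      | zero => rfl
      | succ l ih =>
        have := hk₀ (k₀ + l) (by omega)
        rw [add_assoc] at this
        omega
    have := this ((B k₀).ncard + 1)
    omega
  · push Not at hfin
    have hinf : ∀ k₀, ∃ k > k₀, ∃ x : (Fin n →₀ ℕ) × (Fin n →₀ ℕ),
        (∃ w, ((((0, x.1) : TMon n) : Sig n), w) ∈ G (k + 1) ∧ x.2 = ord.degree (rho π w)) ∧
        ∀ j q, ((((0, j) : TMon n) : Sig n), q) ∈ G k → j ≤ x.1 → ¬ ord.degree (rho π q) ≤ x.2 := by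
      intro k₀
      obtain ⟨k, hk, hlt⟩ := hfin (k₀ + 1)
      obtain ⟨i, w, h1, h2⟩ := (hprog k).2.resolve_left (not_lt.2 hlt)
      exact ⟨k, hk, (i, ord.degree (rho π w)), ⟨w, h1, rfl⟩, h2⟩
    obtain ⟨φ, hφ, hφ'⟩ := Nat.exists_strictMono_subsequence hinf
    choose x hx hx' using hφ'
    obtain ⟨a, b, hab, hle⟩ := wellQuasiOrdered_le x
    obtain ⟨w, hw, hxw⟩ := hx a
    exact hx' b (x a).1 w (hG (Nat.succ_le_of_lt (hφ hab)) hw) hle.1 (hxw ▸ hle.2)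

open Classical in
/-- The number of elements of valuation at most `c` in a multiset. -/
noncomputable def lowCount (c : WithTop ℤ) (Q : Multiset (IntSeries v n)) : ℕ :=
  Q.countP fun q => gval q ≤ c

theorem lowCount_cons_of_le {c : WithTop ℤ} {Q : Multiset (IntSeries v n)} {q : IntSeries v n}
    (h : gval q ≤ c) : lowCount c (q ::ₘ Q) = lowCount c Q + 1 := by
  exact Multiset.countP_cons_of_pos _ h

theorem lowCount_cons_of_lt {c : WithTop ℤ} {Q : Multiset (IntSeries v n)} {q : IntSeries v n}
    (h : c < gval q) : lowCount c (q ::ₘ Q) = lowCount c Q := by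
  exact Multiset.countP_cons_of_neg _ h.not_ge

theorem lowCount_eq_zero {c : WithTop ℤ} {Q : Multiset (IntSeries v n)} :
    lowCount c Q = 0 ↔ ∀ q ∈ Q, c < gval q := by
  simp [lowCount, Multiset.countP_eq_zero]

/-- After a series of valuation `c` has been popped, the run returns to the head of the main loop,
the number of elements of `Q` of valuation at most `c` being unchanged in the meantime. -/
theorem exists_outer_lowCount (hσ : IsRun ord π f σ) {c : WithTop ℤ} {t : ℕ}
    {Q : Multiset (IntSeries v n)} {g : IntSeries v n} {G B : Set (SPair v n)} {S : Set (TMon n)}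
    (ht : σ t = .inner Q g G S B) (hg : gval g = c) :
    ∃ t' ≥ t, ∃ Q' GB', σ t' = .outer Q' GB' ∧ lowCount c Q' = lowCount c Q := by
  have key : ∀ s ≥ t, (∃ t' ≥ t, ∃ Q' GB', σ t' = .outer Q' GB' ∧ lowCount c Q' = lowCount c Q) ∨
      ∃ Q' G' S' B', σ s = .inner Q' g G' S' B' ∧ lowCount c Q' = lowCount c Q := by
    intro s hs
    induction s, hs using Nat.le_induction with
    | base => exact Or.inr ⟨Q, G, S, B, ht, rfl⟩
    | succ s hs ih =>
      rcases ih with h | ⟨Q', G', S', B', h, hQ⟩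
      · exact Or.inl h
      rcases hσ.2 s with h1 | ⟨⟨GB, h1⟩, -⟩
      · rw [h] at h1
        generalize h2 : σ (s + 1) = s₂ at h1
        cases h1 with
        | discard _ _ _ _ _ p hp hd => exact Or.inr ⟨_, _, _, _, rfl, hQ⟩
        | raise _ _ _ _ _ p v₀ hp hcov hdiv hred hval =>
          exact Or.inr ⟨_, _, _, _, rfl, by rw [lowCount_cons_of_lt (hg ▸ hval), hQ]⟩
        | keep _ _ _ _ _ p v₀ hp hcov hdiv hred hval => exact Or.inr ⟨_, _, _, _, rfl, hQ⟩
        | finish _ _ _ _ => exact Or.inl ⟨s + 1, by omega, _, _, h2, hQ⟩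
      · rw [h] at h1; cases h1
  obtain ⟨s, hs, Q₁, GB₁, h1⟩ := exists_outer hσ t
  rcases key s hs with h | ⟨_, _, _, _, h, _⟩
  · exact h
  · rw [h1] at h; cases h

theorem exists_level (hσ : IsRun ord π f σ) (N : ℕ) :
    ∃ t Q GB, σ t = .outer Q GB ∧ ∀ q ∈ Q, ((N : ℤ) : WithTop ℤ) ≤ gval q := by
  induction N with
  | zero => exact ⟨0, _, _, hσ.1, fun q _ => gval_nonneg q⟩
  | succ N ih =>
    obtain ⟨t, Q, GB, ht, hQ⟩ := ih
    obtain ⟨l, hl⟩ : ∃ l, l = lowCount ((N : ℤ) : WithTop ℤ) Q := ⟨_, rfl⟩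
    induction l using Nat.strong_induction_on generalizing t Q GB with
    | h l ih =>
    subst hl
    by_cases h0 : lowCount ((N : ℤ) : WithTop ℤ) Q = 0
    · refine ⟨t, Q, GB, ht, fun q hq => ?_⟩
      have := lowCount_eq_zero.1 h0 q hq
      by_cases hq0 : q = 0
      · rw [gval_eq_top_iff.2 hq0]; exact le_top
      rw [gval_eq_nval hq0] at this ⊢
      have : N < nval q := by exact_mod_cast this
      exact_mod_cast (by omega : N + 1 ≤ nval q)
    · have hex : ∃ q ∈ Q, gval q ≤ ((N : ℤ) : WithTop ℤ) := by
        by_contra! hcon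
        exact h0 (lowCount_eq_zero.2 hcon)
      obtain ⟨q, hq, hqN⟩ := hex
      rcases hσ.2 t with h1 | ⟨⟨GB', h1⟩, -⟩
      · rw [ht] at h1
        generalize h2 : σ (t + 1) = s₂ at h1
        cases h1 with
        | pop Q' _ g hmin =>
          have hg : gval g = ((N : ℤ) : WithTop ℤ) := by
            refine le_antisymm ?_ (hQ g (Multiset.mem_cons_self _ _))
            rcases Multiset.mem_cons.1 hq with rfl | hq
            · exact hqN
            · exact (hmin q hq).trans hqN
          obtain ⟨t', ht', Q'', GB'', h3, h4⟩ := exists_outer_lowCount hσ h2 hg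
          refine ih _ ?_ t' Q'' GB'' h3 ?_ rfl
          · rw [h4, lowCount_cons_of_le hg.le]; omega
          · have := (le_gval_of_le hσ (c := ((N : ℤ) : WithTop ℤ)) (t := t)
              (by rw [ht]; exact hQ) (by rw [ht]; simp [State.current])
              (s := t') (by omega)).1
            rw [h3] at this
            exact this
      · rw [ht] at h1
        cases h1
        exact absurd hq (Multiset.notMem_zero _)

theorem exists_atLevel (hσ : IsRun ord π f σ) (N : ℤ) : ∃ t GB, AtLevel π σ N t GB := by
  obtain ⟨t, Q, GB, ht, hQ⟩ := exists_level hσ N.toNat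
  refine ⟨t, GB, Q, ht, fun q hq => (mem_scaleIdeal_top_iff π).2 (le_trans ?_ (hQ q hq))⟩
  exact_mod_cast N.self_le_toNat

/-- All nonzero series that enter `Q` are popped. -/
theorem mem_Qall_of_mem (hσ : IsRun ord π f σ) {t : ℕ} {w : IntSeries v n}
    (hw : w ∈ poppedUpTo σ t ∪ {q | q ∈ (σ t).queue}) (h0 : w ≠ 0) : w ∈ Qall σ := by
  obtain ⟨t', Q, GB, ht', hQ⟩ := exists_level hσ (nval w + 1)
  have hlev := (le_gval_of_le hσ (c := ((nval w + 1 : ℕ) : ℤ)) (t := t')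
    (by rw [ht']; exact hQ) (by rw [ht']; simp [State.current])
    (le_max_right t t')).1
  rcases poppedUpTo_union_queue_mono hσ (le_max_left t t') hw with h | h
  · exact mem_Qall_of_mem_poppedUpTo h
  · have := hlev w h
    rw [gval_eq_nval h0] at this
    have : nval w + 1 ≤ nval w := by exact_mod_cast this
    omega

end Runs

/-! ### The checkpoints and the ideals `I_N` -/

section Checkpoints

variable {K : Type*} [Field K] {v : AddValuation K (WithTop ℤ)} {n : ℕ}
  {ord : MonomialOrder (Fin n)} {π : Uniformizer v} {m : ℕ} {f : Fin m → IntSeries v n}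
  {σ : ℕ → State v n}

theorem coe_add_one_le_iff_not_le {N : ℤ} {x : WithTop ℤ} :
    ((N + 1 : ℤ) : WithTop ℤ) ≤ x ↔ ¬ x ≤ (N : WithTop ℤ) := by
  cases x with
  | top => simp
  | coe a =>
    have : N + 1 ≤ a ↔ ¬ a ≤ N := by omega
    exact_mod_cast this

/-- All series popped up to the checkpoint `τ_{N+1}` have a valuation at most `N`. -/
theorem gval_le_of_mem_current (hσ : IsRun ord π f σ) {N : ℤ} {t : ℕ}
    (ht : ∀ s < t, ∀ GB, ¬ AtLevel π σ (N + 1) s GB) {s : ℕ} (hs : s ≤ t) {g : IntSeries v n}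
    (hg : g ∈ (σ s).current) : gval g ≤ (N : WithTop ℤ) := by
  induction s with
  | zero => rw [hσ.1] at hg; exact absurd hg (Set.notMem_empty _)
  | succ s ih =>
    rcases hσ.2 s with h | ⟨⟨GB, h⟩, h'⟩
    · generalize h₁ : σ s = s₁ at *
      generalize σ (s + 1) = s₂ at *
      cases h with
      | pop Q GB f hmin =>
        obtain rfl : g = f := hg
        have hnot : ¬ ∀ q ∈ g ::ₘ Q, q ∈ scaleIdeal π (N + 1) (⊤ : Ideal (IntSeries v n)) :=
          fun hall => ht s (by omega) GB ⟨_, h₁, hall⟩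
        push Not at hnot
        obtain ⟨q, hq, hqN⟩ := hnot
        rw [mem_scaleIdeal_top_iff, coe_add_one_le_iff_not_le, not_not] at hqN
        rcases Multiset.mem_cons.1 hq with rfl | hq
        · exact hqN
        · exact (hmin q hq).trans hqN
      | finish Q f G S => exact absurd hg (Set.notMem_empty _)
      | _ => exact ih (by omega) hg
    · rw [h', h] at hg; exact absurd hg (Set.notMem_empty _)

/-- At the checkpoint `τ_{N+1}`, the series popped so far are those of `Q_{≤ N}`, and the series
left in `Q` are zero or belong to `Q_{> N}`. -/
theorem exists_checkpoint (hσ : IsRun ord π f σ) (N : ℤ) :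
    ∃ t Q GB, σ t = .outer Q GB ∧ IsGBasisAt π σ (N + 1) GB ∧ poppedUpTo σ t = Qle σ N ∧
      ∀ q ∈ Q, q = 0 ∨ q ∈ Qgt σ N := by
  classical
  have hex := exists_atLevel hσ (N + 1)
  have hmin : ∀ s < Nat.find hex, ∀ GB, ¬ AtLevel π σ (N + 1) s GB := fun s hs GB h =>
    Nat.find_min hex hs ⟨GB, h⟩
  obtain ⟨GB, hGB⟩ := Nat.find_spec hex
  generalize Nat.find hex = t at *
  obtain ⟨Q, hQ, hlev⟩ := id hGB
  refine ⟨t, Q, GB, hQ, ⟨t, hGB, hmin⟩, ?_, ?_⟩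
  · ext g
    constructor
    · rintro ⟨s, hs, hg⟩
      exact ⟨mem_Qall_iff.2 ⟨s, hg⟩, gval_le_of_mem_current hσ hmin hs hg⟩
    · rintro ⟨hg, hgN⟩
      obtain ⟨s, hg⟩ := mem_Qall_iff.1 hg
      by_contra hcon
      have hts : t ≤ s := by
        by_contra! hst
        exact hcon ⟨s, hst.le, hg⟩
      have := (le_gval_of_le hσ (c := ((N + 1 : ℤ) : WithTop ℤ)) (t := t)
        (by rw [hQ]; exact fun q hq => (mem_scaleIdeal_top_iff π).1 (hlev q hq))
        (by rw [hQ]; simp [State.current]) hts).2 g hg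
      exact coe_add_one_le_iff_not_le.1 this hgN
  · intro q hq
    by_cases hq0 : q = 0
    · exact Or.inl hq0
    refine Or.inr ⟨mem_Qall_of_mem hσ (t := t) (Or.inr (by rw [hQ]; exact hq)) hq0, ?_⟩
    exact not_le.1 (coe_add_one_le_iff_not_le.1 ((mem_scaleIdeal_top_iff π).1 (hlev q hq)))

theorem Qle_eq_empty_of_neg {N : ℤ} (hN : N < 0) : Qle σ N = ∅ := by
  refine Set.eq_empty_iff_forall_notMem.2 fun g hg => ?_
  have h := (gval_nonneg g).trans hg.2
  have h : (0 : ℤ) ≤ N := by exact_mod_cast h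
  omega

theorem ne_zero_of_mem_Qle {N : ℕ} {d : IntSeries v n} (hd : d ∈ Qle σ N) :
    d ≠ 0 ∧ nval d ≤ N := by
  have hd0 : d ≠ 0 := by
    rintro rfl
    have h := hd.2
    rw [gval_eq_top_iff.2 rfl] at h
    exact absurd h (by simp)
  have h := hd.2
  rw [gval_eq_nval hd0] at h
  exact ⟨hd0, by exact_mod_cast h⟩

theorem exists_unif_pow_succ_mul_of_mem_Qgt (π : Uniformizer v) {N : ℕ} {w : IntSeries v n}
    (hw : w ∈ Qgt σ N) : ∃ y, unif π n ^ (N + 1) * y = w := by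
  apply (le_gval_iff_dvd π).1
  have := coe_add_one_le_iff_not_le.2 (not_le.2 hw.2)
  exact_mod_cast this

/-- The elements of `⟨ν(Q_{≤ N})⟩` divisible by `π`: the syzygies of `ρ(Q_{≤ N})` lift. -/
theorem mem_sup_of_mem_nuIdeal (hσ : IsRun ord π f σ) {N : ℤ} {x : IntSeries v n}
    (hx : x ∈ nuIdeal π (Qle σ N)) (hx0 : red x = 0) :
    x ∈ Ideal.span {unif π n} * nuIdeal π (Qle σ N) ⊔
      Ideal.span (scaleSet π (-N) (Qgt σ N)) := by
  rcases lt_or_ge N 0 with hN | hN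
  · rw [Qle_eq_empty_of_neg hN, nuIdeal, Set.image_empty, Ideal.span_empty] at hx
    rw [show x = 0 from hx]
    exact Ideal.zero_mem _
  lift N to ℕ using hN
  obtain ⟨t, Q, GB, ht, -, hD, hQ⟩ := exists_checkpoint hσ N
  have hinv := stateInv hσ t
  rw [ht, hD] at hinv
  obtain ⟨z, hz, hxz⟩ := hinv.lift_syzygy x hx hx0
  have hle : Ideal.span (raisedSet π (Qle σ N) (Qle σ N ∪ {q | q ∈ Q})) ≤
      Ideal.span {unif π n} * nuIdeal π (Qle σ N) ⊔
        Ideal.span (scaleSet π (-(N : ℤ)) (Qgt σ N)) := by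
    rw [Ideal.span_le]
    rintro e ⟨d, hd, w, hw, hdw, hew⟩
    obtain ⟨hd0, hdN⟩ := ne_zero_of_mem_Qle hd
    by_cases hw0 : w = 0
    · rw [hw0] at hew
      have : e = 0 := unif_pow_mul_cancel π (nval d) (hew.trans (mul_zero _).symm)
      rw [this]
      exact Ideal.zero_mem _
    rw [gval_eq_nval hd0, gval_eq_nval hw0] at hdw
    have hdw : nval d < nval w := by exact_mod_cast hdw
    rcases hw with hw | hw
    · apply Ideal.mem_sup_left
      obtain ⟨l, hl⟩ := Nat.exists_eq_add_of_lt hdw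
      have he : e = unif π n * (unif π n ^ l * nu π w) := by
        apply unif_pow_mul_cancel π (nval d)
        conv_lhs => rw [hew, ← unif_pow_mul_nu π w, hl]
        ring
      rw [he]
      exact Ideal.mul_mem_mul (Ideal.mem_span_singleton_self _)
        (Ideal.mul_mem_left _ _ (Ideal.subset_span ⟨w, hw, rfl⟩))
    · apply Ideal.mem_sup_right
      have hwQ := (hQ w hw).resolve_left hw0
      obtain ⟨y, hy⟩ := exists_unif_pow_succ_mul_of_mem_Qgt π hwQ
      have he : e = unif π n ^ (N - nval d) * (unif π n * y) := by
        apply unif_pow_mul_cancel π (nval d)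
        rw [hew, ← mul_assoc, ← pow_add, Nat.add_sub_cancel' hdN, ← hy, pow_succ, mul_assoc]
      rw [he]
      refine Ideal.mul_mem_left _ _ (Ideal.subset_span ?_)
      rw [mem_scaleSet_neg_natCast, ← mul_assoc, ← pow_succ, hy]
      exact hwQ
  have := Ideal.add_mem _ (hle hxz) (Ideal.mem_sup_left
    (Ideal.mul_mem_mul (Ideal.mem_span_singleton_self (unif π n)) hz))
  rwa [sub_add_cancel] at this

theorem span_scaleSet_natCast (π : Uniformizer v) (N : ℕ) (A : Set (IntSeries v n)) :
    Ideal.span (scaleSet π (N : ℤ) A) = Ideal.span {unif π n ^ N} * Ideal.span A := by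
  have : scaleSet π (N : ℤ) A = (fun x => unif π n ^ N * x) '' A := by
    ext g; exact mem_scaleSet_natCast π
  rw [this, Ideal.span_mul_span', Set.singleton_mul]

theorem mem_idealLevel_iff {I : Ideal (IntSeries v n)} {N : ℤ} {g : IntSeries v n} :
    g ∈ idealLevel π I N ↔ g ∈ I ∧ (N : WithTop ℤ) ≤ gval g := by
  rw [idealLevel, Ideal.mem_inf, mem_scaleIdeal_top_iff]

theorem span_le_idealLevel (hσ : IsRun ord π f σ) (N : ℤ) :
    Ideal.span (scaleSet π N (nu π '' Qle σ N) ∪ Qgt σ N) ≤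
      idealLevel π (Ideal.span (Set.range f)) N := by
  have hall : Qall σ ⊆ (Ideal.span (Set.range f) : Ideal (IntSeries v n)) := by
    intro g hg
    obtain ⟨t, hg⟩ := mem_Qall_iff.1 hg
    exact poppedUpTo_union_queue_subset hσ t (Or.inl ⟨t, le_rfl, hg⟩)
  rw [Ideal.span_le]
  rintro g (hg | hg)
  · rcases lt_or_ge N 0 with hN | hN
    · obtain ⟨_, ⟨d, hd, -⟩, -⟩ := hg
      rw [Qle_eq_empty_of_neg hN] at hd
      exact absurd hd (Set.notMem_empty _)
    lift N to ℕ using hN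
    obtain ⟨_, ⟨d, hd, rfl⟩, rfl⟩ := (mem_scaleSet_natCast π).1 hg
    refine mem_idealLevel_iff.2 ⟨?_, (le_gval_iff_dvd π).2 ⟨_, rfl⟩⟩
    rw [← Nat.sub_add_cancel (ne_zero_of_mem_Qle hd).2, pow_add, mul_assoc, unif_pow_mul_nu]
    exact Ideal.mul_mem_left _ _ (hall hd.1)
  · exact mem_idealLevel_iff.2 ⟨hall hg.1, hg.2.le⟩

theorem Qgt_subset_succ (π : Uniformizer v) {N : ℤ} (hN : -1 ≤ N) :
    Qgt σ N ⊆ scaleSet π (N + 1) (nu π '' Qle σ (N + 1)) ∪ Qgt σ (N + 1) := by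
  intro w hw
  by_cases hlt : ((N + 1 : ℤ) : WithTop ℤ) < gval w
  · exact Or.inr ⟨hw.1, hlt⟩
  left
  have heq : gval w = ((N + 1 : ℤ) : WithTop ℤ) :=
    le_antisymm (not_lt.1 hlt) (coe_add_one_le_iff_not_le.2 (not_le.2 hw.2))
  obtain ⟨k, hk⟩ := Int.eq_ofNat_of_zero_le (by omega : 0 ≤ N + 1)
  rw [hk] at heq ⊢
  rw [mem_scaleSet_natCast]
  refine ⟨_, ⟨w, ⟨hw.1, heq.le⟩, rfl⟩, ?_⟩
  rw [← (nval_eq_of_gval_eq heq).2, unif_pow_mul_nu]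

theorem nuIdeal_Qle_mono {N N' : ℤ} (h : N ≤ N') : nuIdeal π (Qle σ N) ≤ nuIdeal π (Qle σ N') :=
  nuIdeal_mono π fun _ hd => ⟨hd.1, hd.2.trans (by exact_mod_cast h)⟩

/-- The ideal `I_N` is generated by `π^N ν(Q_{≤ N})` and `Q_{> N}`. When `N` increases by one, an
element of `I_N` divisible by `π^(N+1)` has, on `π^N ν(Q_{≤ N})`, coefficients that form a syzygy
modulo `π`, which lifts. -/
theorem idealLevel_le_span (hσ : IsRun ord π f σ) (N : ℤ) :
    idealLevel π (Ideal.span (Set.range f)) N ≤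
      Ideal.span (scaleSet π N (nu π '' Qle σ N) ∪ Qgt σ N) := by
  have hneg : ∀ N : ℤ, N < 0 → idealLevel π (Ideal.span (Set.range f)) N ≤
      Ideal.span (scaleSet π N (nu π '' Qle σ N) ∪ Qgt σ N) := by
    intro N hN
    refine inf_le_left.trans (Ideal.span_le.2 ?_)
    rintro _ ⟨i, rfl⟩
    by_cases h0 : f i = 0
    · rw [h0]; exact Ideal.zero_mem _
    refine Ideal.subset_span (Or.inr ⟨mem_Qall_of_mem hσ (t := 0) (Or.inr ?_) h0, ?_⟩)
    · rw [hσ.1]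
      change f i ∈ Finset.univ.val.map f
      exact Multiset.mem_map_of_mem f (Finset.mem_univ_val i)
    · refine lt_of_lt_of_le ?_ (gval_nonneg (f i))
      exact_mod_cast hN
  rcases lt_or_ge N (-1) with hN | hN
  · exact hneg N (by omega)
  induction N, hN using Int.leInduction with
  | base => exact hneg _ (by norm_num)
  | succ N hN ih =>
    intro h hh
    obtain ⟨hI, hlev⟩ := mem_idealLevel_iff.1 hh
    have hmem := ih (mem_idealLevel_iff.2 ⟨hI, le_trans
      (by exact_mod_cast (by omega : N ≤ N + 1)) hlev⟩)
    have hgt : Ideal.span (Qgt σ N) ≤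
        Ideal.span (scaleSet π (N + 1) (nu π '' Qle σ (N + 1)) ∪ Qgt σ (N + 1)) :=
      Ideal.span_mono (Qgt_subset_succ π hN)
    rw [Ideal.span_union] at hmem
    rcases lt_or_ge N 0 with h0 | h0
    · have hemp : scaleSet π N (nu π '' Qle σ N) = ∅ := by
        rw [Qle_eq_empty_of_neg h0, Set.image_empty]
        exact Set.eq_empty_iff_forall_notMem.2 fun _ ⟨_, h, _⟩ => h
      rw [hemp, Ideal.span_empty, bot_sup_eq] at hmem
      exact hgt hmem
    lift N to ℕ using h0
    rw [span_scaleSet_natCast] at hmem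
    obtain ⟨x, hx, g, hg, rfl⟩ := Submodule.mem_sup.1 hmem
    obtain ⟨z, hz, rfl⟩ := Ideal.mem_span_singleton_mul.1 hx
    have hgl : g ∈ scaleIdeal π ((N : ℤ) + 1) (⊤ : Ideal (IntSeries v n)) := by
      refine (Ideal.span_le (I := scaleIdeal π ((N : ℤ) + 1) ⊤)).2 (fun w hw => ?_) hg
      exact (mem_scaleIdeal_top_iff π).2 (coe_add_one_le_iff_not_le.2 (not_le.2 hw.2))
    have hzl := Ideal.sub_mem _ ((mem_scaleIdeal_top_iff π).2 hlev) hgl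
    rw [add_sub_cancel_right, mem_scaleIdeal_top_iff, ← Nat.cast_succ, le_gval_iff_dvd π] at hzl
    obtain ⟨y, hy⟩ := hzl
    have hz0 : red z = 0 := by
      refine (red_eq_zero_iff π).2 ⟨y, unif_pow_mul_cancel π N ?_⟩
      rw [← hy, Nat.succ_eq_add_one, pow_succ, mul_assoc]
    obtain ⟨_, hx₁, z₂, hz₂, rfl⟩ := Submodule.mem_sup.1 (mem_sup_of_mem_nuIdeal hσ hz hz0)
    obtain ⟨z₁, hz₁, rfl⟩ := Ideal.mem_span_singleton_mul.1 hx₁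
    refine Ideal.add_mem _ ?_ (hgt hg)
    rw [mul_add]
    refine Ideal.add_mem _ ?_ (hgt ?_)
    · refine Ideal.span_mono Set.subset_union_left ?_
      rw [← Nat.cast_succ, span_scaleSet_natCast, ← mul_assoc, ← pow_succ]
      exact Ideal.mul_mem_mul (Ideal.mem_span_singleton_self _)
        (nuIdeal_Qle_mono (by simp) hz₁)
    · refine Submodule.span_induction ?_ ?_ ?_ ?_ hz₂
      · intro e he
        exact Ideal.subset_span ((mem_scaleSet_neg_natCast π).1 he)
      · rw [mul_zero]; exact Ideal.zero_mem _
      · intro a b _ _ ha hb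
        rw [mul_add]; exact Ideal.add_mem _ ha hb
      · intro a b _ hb
        rw [smul_eq_mul, mul_left_comm]; exact Ideal.mul_mem_left _ _ hb

theorem idealLevel_eq_span (hσ : IsRun ord π f σ) (N : ℤ) :
    idealLevel π (Ideal.span (Set.range f)) N =
      Ideal.span (scaleSet π N (nu π '' Qle σ N) ∪ Qgt σ N) :=
  le_antisymm (idealLevel_le_span hσ N) (span_le_idealLevel hσ N)

theorem idealBar_eq_span (hσ : IsRun ord π f σ) (N : ℤ) :
    idealBar π (Ideal.span (Set.range f)) N = Ideal.span (rho π '' Qle σ N) := by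
  apply le_antisymm
  · intro p hp
    obtain ⟨g, hg, rfl⟩ := (mem_idealBar π _ N p).1 hp
    rcases lt_or_ge N 0 with hN | hN
    · -- for negative `N`, the members of `π^(-N) I` reduce to zero
      obtain ⟨h, -, hgh⟩ := hg
      have h1 : ((-N : ℤ) : WithTop ℤ) ≤ gval g :=
        (mem_scaleIdeal_top_iff π).1 ⟨h, trivial, hgh⟩
      rw [red_eq_zero_of_lt π (lt_of_lt_of_le (by exact_mod_cast (by omega : 0 < -N)) h1)]
      exact Ideal.zero_mem _
    lift N to ℕ using hN
    rw [mem_scaleSet_neg_natCast] at hg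
    have hg := idealLevel_le_span hσ N hg
    rw [Ideal.span_union, span_scaleSet_natCast] at hg
    obtain ⟨x, hx, w, hw, hxw⟩ := Submodule.mem_sup.1 hg
    obtain ⟨z, hz, rfl⟩ := Ideal.mem_span_singleton_mul.1 hx
    have hwl : w ∈ scaleIdeal π ((N : ℤ) + 1) (⊤ : Ideal (IntSeries v n)) := by
      refine (Ideal.span_le (I := scaleIdeal π ((N : ℤ) + 1) ⊤)).2 (fun w hw => ?_) hw
      exact (mem_scaleIdeal_top_iff π).2 (coe_add_one_le_iff_not_le.2 (not_le.2 hw.2))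
    rw [mem_scaleIdeal_top_iff, ← Nat.cast_succ, le_gval_iff_dvd π] at hwl
    obtain ⟨y, rfl⟩ := hwl
    have hgz : g = z + unif π n * y := by
      apply unif_pow_mul_cancel π N
      rw [← hxw, Nat.succ_eq_add_one]
      ring
    rw [hgz, map_add, map_mul, red_unif, zero_mul, add_zero]
    exact red_mem_of_mem_nuIdeal π hz
  · rw [Ideal.span_le]
    rintro _ ⟨d, hd, rfl⟩
    rcases lt_or_ge N 0 with hN | hN
    · rw [Qle_eq_empty_of_neg hN] at hd
      exact absurd hd (Set.notMem_empty _)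
    lift N to ℕ using hN
    refine (mem_idealBar π _ _ _).2 ⟨nu π d, (mem_scaleSet_neg_natCast π).2 ?_, rfl⟩
    exact span_le_idealLevel hσ N (Ideal.subset_span (Or.inl ((mem_scaleSet_natCast π).2
      ⟨_, ⟨d, hd, rfl⟩, rfl⟩)))

theorem map_syzMod_le (hσ : IsRun ord π f σ) (N : ℤ) :
    ((syzMod π σ N).map (phi π σ N) : Ideal (IntSeries v n)) ≤
      Ideal.span (scaleSet π 1 (nu π '' Qle σ N) ∪ scaleSet π (-N) (Qgt σ N)) := by
  rintro _ ⟨a, ha, rfl⟩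
  have h1 : phi π σ N a ∈ nuIdeal π (Qle σ N) := by
    have h2 : phi π σ N a ∈ LinearMap.range (phi π σ N) := ⟨a, rfl⟩
    rw [phi, Finsupp.range_linearCombination] at h2
    rw [nuIdeal, Set.image_eq_range]
    exact h2
  have h2 : red (phi π σ N a) = 0 := by
    apply red_eq_zero_of_lt π
    refine lt_of_lt_of_le ?_ ((mem_scaleIdeal_top_iff π).1 ha)
    exact_mod_cast zero_lt_one (α := ℤ)
  have h3 := mem_sup_of_mem_nuIdeal hσ h1 h2
  have h4 := span_scaleSet_natCast π 1 (nu π '' Qle σ N)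
  rw [pow_one, Nat.cast_one] at h4
  rw [Ideal.span_union, h4]
  exact h3

end Checkpoints

end Tate

theorem mainTheorem3 {K : Type*} [Field K] (v : AddValuation K (WithTop ℤ))
    (hK : Tate.IsCompleteField v) (π : Tate.Uniformizer v) {n : ℕ}
    (ord : MonomialOrder (Fin n)) {m : ℕ} (f : Fin m → Tate.IntSeries v n)
    (σ : ℕ → Tate.State v n) (hσ : Tate.IsRun ord π f σ) (N : ℤ) :
    (Tate.Qle σ N).Finite ∧
    (∃ GBasis, Tate.IsGBasisAt π σ (N + 1) GBasis ∧
      Tate.IsGroebnerBasis ord (Tate.rho π '' GBasis)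
        (Tate.idealBar π (Ideal.span (Set.range f)) N)) ∧
    (((Tate.syzMod π σ N).map (Tate.phi π σ N) : Ideal (Tate.IntSeries v n)) ≤
      Ideal.span (Tate.scaleSet π 1 (Tate.nu π '' Tate.Qle σ N) ∪
        Tate.scaleSet π (-N) (Tate.Qgt σ N))) ∧
    Tate.idealLevel π (Ideal.span (Set.range f)) (N + 1) =
      Ideal.span (Tate.scaleSet π (N + 1) (Tate.nu π '' Tate.Qle σ (N + 1)) ∪
        Tate.Qgt σ (N + 1)) ∧
    Tate.idealBar π (Ideal.span (Set.range f)) (N + 1) =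
      Ideal.span (Tate.rho π '' Tate.Qle σ (N + 1)) := by
  obtain ⟨t, Q, GB, ht, hGB, hD, -⟩ := Tate.exists_checkpoint hσ N
  have hinv := Tate.stateInv hσ t
  rw [ht, hD] at hinv
  refine ⟨hD ▸ Tate.finite_poppedUpTo σ t, ⟨GB, hGB, ?_⟩, Tate.map_syzMod_le hσ N,
    Tate.idealLevel_eq_span hσ (N + 1), Tate.idealBar_eq_span hσ (N + 1)⟩
  rw [Tate.idealBar_eq_span hσ N]
  exact hinv.groebner
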